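/- Let $A$ be a finite-dimensional semisimple $\mathbb{Q}$-algebra and let $\mathfrak{A}\subseteq A$ be an order, i.e. a (unital) subring which is finitely generated as a $\mathbb{Z}$-module and satisfies $\mathbb{Q}\cdot\mathfrak{A}=A$. Let $\mathsf{LCA}_{\mathfrak{A}}$ (resp. ${}_{\mathfrak{A}}\mathsf{LCA}$) be the category whose objects are the right (resp. left) $\mathfrak{A}$-modules $M$ equipped with a locally compact Hausdorff group topology on $(M,+)$ for which the action of each $\alpha\in\mathfrak{A}$ is continuous, and whose morphisms are the continuous $\mathfrak{A}$-module homomorphisms. These categories carry their natural exact structures, in which the short exact sequences are the kernel-cokernel pairs $X\overset{i}{\to}Y\overset{p}{\to}Z$ (i.e. $i$ is a kernel of $p$ and $p$ is a cokernel of $i$); the maps $i$ occurring in them are the admissible monics and the maps $p$ the admissible epics. An object $V$ is injective if for every admissible monic $i:X\to Y$ every morphism $f:X\to V$ is of the form $f=g\circ i$ for some morphism $g:Y\to V$, and projective if for every admissible epic $p:Y\to Z$ every morphism $f:V\to Z$ is of the form $f=p\circ g$ for some morphism $g:V\to Y$. A vector $\mathfrak{A}$-module is an object whose underlying topological group is isomorphic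 to $\mathbb{R}^{n}$ for some $n\geq 0$. Theorem. Every right vector $\mathfrak{A}$-module is both an injective and a projective object of $\mathsf{LCA}_{\mathfrak{A}}$, and every left vector $\mathfrak{A}$-module is both an injective and a projective object of ${}_{\mathfrak{A}}\mathsf{LCA}$. -/

import Mathlib

open CategoryTheory CategoryTheory.Limits

universe u v

/-- A `ℤ`-order in a `ℚ`-algebra `A`: a (unital) subring that is finitely generated as a
`ℤ`-module and satisfies `ℚ · 𝔄 = A`. -/
structure IsOrder {A : Type v} [Ring A] [Algebra ℚ A] (𝔄 : Subring A) : Prop where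
  finite : Module.Finite ℤ 𝔄
  span_eq_top : Submodule.span ℚ (𝔄 : Set A) = ⊤

/-- Locally compact left `R`-modules: a left `R`-module together with a locally compact Hausdorff
group topology on its additive group, such that every scalar acts continuously. -/
structure LCAMod (R : Type v) [Ring R] where
  carrier : Type u
  [addCommGroup : AddCommGroup carrier]
  [module : Module R carrier]
  [topologicalSpace : TopologicalSpace carrier]
  [isTopologicalAddGroup : IsTopologicalAddGroup carrier]
  [locallyCompactSpace : LocallyCompactSpace carrier]
  [t2Space : T2Space carrier]
  [continuousConstSMul : ContinuousConstSMul R carrier]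

/-- Locally compact right `R`-modules. A right `R`-module is a module over the opposite ring. -/
abbrev RightLCAMod (R : Type v) [Ring R] : Type (max (u + 1) v) := LCAMod.{u} Rᵐᵒᵖ

namespace LCAMod

variable {R : Type v} [Ring R]

instance : CoeSort (LCAMod.{u} R) (Type u) := ⟨LCAMod.carrier⟩

attribute [instance] addCommGroup module topologicalSpace isTopologicalAddGroup
  locallyCompactSpace t2Space continuousConstSMul

/-- Morphisms are the continuous `R`-linear maps. -/
instance : Category.{u} (LCAMod.{u} R) where
  Hom X Y := X →L[R] Y
  id X := ContinuousLinearMap.id R X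
  comp f g := ContinuousLinearMap.comp g f

instance : HasZeroMorphisms (LCAMod.{u} R) where
  zero X Y := ⟨(0 : X →L[R] Y)⟩
  comp_zero {X Y} (f : X →L[R] Y) Z :=
    show (0 : Y →L[R] Z).comp f = 0 from ContinuousLinearMap.zero_comp f
  zero_comp X {Y Z} (f : Y →L[R] Z) :=
    show f.comp (0 : X →L[R] Y) = 0 from ContinuousLinearMap.comp_zero f

/-- A vector module: the underlying topological group is isomorphic to some `ℝⁿ`, `n ≥ 0`. -/
def IsVectorModule (V : LCAMod.{u} R) : Prop :=
  ∃ n : ℕ, Nonempty (V ≃ₜ+ (Fin n → ℝ))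

end LCAMod

section ExactStructure

variable {C : Type v} [Category.{u} C] [HasZeroMorphisms C]

/-- The short exact sequences of the natural exact structure of a quasi-abelian category: the
kernel-cokernel pairs, i.e. `X ⟶ Y ⟶ Z` where the first map is a kernel of the second and the
second is a cokernel of the first. -/
def IsKernelCokernelPair (S : ShortComplex C) : Prop :=
  Nonempty (IsLimit (KernelFork.ofι S.f S.zero)) ∧
    Nonempty (IsColimit (CokernelCofork.ofπ S.g S.zero))

/-- Admissible monics: the first maps of short exact sequences. -/
def IsAdmissibleMonic {X Y : C} (i : X ⟶ Y) : Prop :=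
  ∃ (Z : C) (p : Y ⟶ Z) (w : i ≫ p = 0), IsKernelCokernelPair (ShortComplex.mk i p w)

/-- Admissible epics: the second maps of short exact sequences. -/
def IsAdmissibleEpic {Y Z : C} (p : Y ⟶ Z) : Prop :=
  ∃ (X : C) (i : X ⟶ Y) (w : i ≫ p = 0), IsKernelCokernelPair (ShortComplex.mk i p w)

/-- Injective objects of an exact category: morphisms to `V` extend along admissible monics. -/
def IsInjectiveObject (V : C) : Prop :=
  ∀ ⦃X Y : C⦄ (i : X ⟶ Y), IsAdmissibleMonic i →
    ∀ f : X ⟶ V, ∃ g : Y ⟶ V, i ≫ g = f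

/-- Projective objects of an exact category: morphisms from `V` lift along admissible epics. -/
def IsProjectiveObject (V : C) : Prop :=
  ∀ ⦃Y Z : C⦄ (p : Y ⟶ Z), IsAdmissibleEpic p →
    ∀ f : V ⟶ Z, ∃ g : V ⟶ Y, g ≫ p = f

end ExactStructure

/-! The statement reduces to topological groups by averaging. If `g` is a continuous additive
extension or lift of a module map `f`, then `∑ e i • g (f i • x)` is linear over the order as soon
as the two families of scalars transform contragrediently under multiplication by ring elements,
with integer matrices. If moreover `∑ e i * f i = N ≠ 0`, the averaged map extends or lifts `N • f`,
and `N` is invertible on a vector module. Such families exist by `IsOrder.hasAveragingFamily`: a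
`ℤ`-basis of the order, and its dual basis for the regular trace form with denominators cleared.
Semisimplicity makes this form nondegenerate.

Admissible monics are closed embeddings and admissible epics are open, so two facts about locally
compact abelian groups remain.

Extension (`AddSubgroup.exists_extension_real`): a real character of a closed subgroup is extended
step by step to an open subgroup. Adjoining one element `g` to a closed subgroup `H` either gives a
subgroup in which `H` is open, or, after closure, one that is cocompact over `H`. Divisibility of
`ℝ` extends the character in the first case. In the second, a bounded-error extension is corrected
to an additive one.

Lifting (`exists_lift_real`): pulling back along a one-parameter subgroup turns a lift into a
section of some `π : E →+ ℝ`. The same induction gives a compactly generated open subgroup a proper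
map to some `ℝⁿ`. Its closed image contains a line on which `π` is onto, and `π` is proper over that
line. On a minimal closed subgroup that still surjects, `π` is injective, for a kernel element
detected by a character would yield a smaller such subgroup. Separation of points by characters
comes from the regular representation and Gelfand theory. -/

set_option linter.unusedSectionVars false

/-! ### Characters from commutative C⋆-algebras -/

/-- A unitary representation in a C⋆-algebra which becomes norm continuous after multiplication by
a commuting self-adjoint element `K`, and for which `c` acts nontrivially on `K`, gives a continuous
character that is nontrivial at `c`. -/
theorem exists_continuous_character_of_unitary {G B : Type*} [CommGroup G] [TopologicalSpace G]
    [CStarAlgebra B] (U : G →* unitary B) (K : B) (hK : IsSelfAdjoint K)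
    (hUK : ∀ g, Commute (U g : B) K) (hcont : Continuous fun g => (U g : B) * K) {c : G}
    (hc : (U c : B) * K ≠ K) : ∃ χ : G →* Circle, Continuous χ ∧ χ c ≠ 1 := by
  let S : Set B := Set.range (fun g => (U g : B)) ∪ {K}
  have hUU : ∀ g h, Commute (U g : B) (U h) := fun g h => by
    have : U g * U h = U h * U g := by rw [← map_mul, ← map_mul, mul_comm]
    exact congrArg Subtype.val this
  have hstar : ∀ x ∈ S, star x ∈ S := by
    rintro x (⟨g, rfl⟩ | rfl)
    · refine Or.inl ⟨g⁻¹, ?_⟩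
      simp [← Unitary.star_eq_inv]
    · exact Or.inr hK
  have hcomm : ∀ x ∈ S, ∀ y ∈ S, x * y = y * x := by
    rintro x (⟨g, rfl⟩ | rfl) y (⟨h, rfl⟩ | rfl)
    · exact hUU g h
    · exact hUK g
    · exact (hUK h).symm
    · rfl
  have cr := StarAlgebra.isMulCommutative_adjoin ℂ hcomm
    (fun x hx y hy => hcomm x hx _ (hstar y hy))
  let A := (StarAlgebra.adjoin ℂ S).topologicalClosure
  have hAc : ∀ x y : A, x * y = y * x := by
    let := StarSubalgebra.commRingTopologicalClosure (StarAlgebra.adjoin ℂ S)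
      (fun x y => cr.is_comm.comm x y)
    exact fun x y => this.mul_comm x y
  have hclosed : IsClosed (A : Set B) := StarSubalgebra.isClosed_topologicalClosure _
  have : IsClosed (A : Set B) := hclosed
  let : CommCStarAlgebra A := { (inferInstance : CStarAlgebra A) with mul_comm := hAc }
  have hmem : ∀ x ∈ S, x ∈ A := fun x hx =>
    StarSubalgebra.le_topologicalClosure _ (StarAlgebra.subset_adjoin ℂ S hx)
  let u : G → A := fun g => ⟨U g, hmem _ (Or.inl ⟨g, rfl⟩)⟩
  let k : A := ⟨K, hmem _ (Or.inr rfl)⟩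
  have hx : u c * k - k ≠ 0 := fun h => hc (by
    have := congrArg Subtype.val h
    simpa [sub_eq_zero] using this)
  -- The Gelfand transform is isometric, so some `ω` sees this element, and then `ω k ≠ 0`. Hence `ω
  -- (u g) = ω (u g * k) / ω k` is continuous in `g`, although `u` itself need not be norm
  -- continuous.
  obtain ⟨ω, hω⟩ : ∃ ω : WeakDual.characterSpace ℂ A, ω (u c * k - k) ≠ 0 := by
    by_contra! h
    apply hx
    apply (gelfandTransform_isometry A).injective
    ext ω
    simpa using h ω
  have hu1 : u 1 = 1 := Subtype.ext (by simp [u])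
  have hum : ∀ g h, u (g * h) = u g * u h := fun g h => Subtype.ext (by simp [u])
  have hkk : ω k ≠ 0 := fun h => hω (by rw [map_sub, map_mul, h]; simp)
  have hnorm : ∀ g, ω (u g) ∈ Submonoid.unitSphere ℂ := by
    intro g
    have h1 : star (u g) * u g = 1 := Subtype.ext (by simp [u])
    have h2 := congrArg ω h1
    rw [map_mul, map_star, map_one] at h2
    rw [Submonoid.unitSphere, ← Submonoid.mem_carrier, mem_sphere_zero_iff_norm]
    have h3 : ‖star (ω (u g)) * ω (u g)‖ = 1 := by rw [h2]; simp
    rw [norm_mul, norm_star] at h3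
    nlinarith [norm_nonneg (ω (u g))]
  let χ : G →* Circle :=
    { toFun := fun g => ⟨ω (u g), hnorm g⟩
      map_one' := Subtype.ext (by simp [hu1])
      map_mul' := fun g h => Subtype.ext (by simp [hum]; rfl) }
  refine ⟨χ, ?_, fun h => hω ?_⟩
  · refine continuous_induced_rng.2 ?_
    have h1 : Continuous fun g => u g * k := Continuous.subtype_mk hcont _
    have h2 : Continuous fun g => ω (u g * k) / ω k :=
      ((map_continuous ω).comp h1).div_const _
    refine h2.congr fun g => ?_
    rw [map_mul, mul_div_cancel_right₀ _ hkk]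
    rfl
  · have : ω (u c) = 1 := congrArg Subtype.val h
    rw [map_sub, map_mul, this, one_mul, sub_self]

/-! ### Smoothing operators of unitary representations -/

section UnitaryRepresentation

open MeasureTheory Topology

variable {G E : Type*} [CommGroup G] [TopologicalSpace G] [IsTopologicalGroup G]
  [LocallyCompactSpace G] [MeasurableSpace G] [BorelSpace G]
  [NormedAddCommGroup E] [InnerProductSpace ℂ E] [CompleteSpace E]
  {U : G →* (E ≃ₗᵢ[ℂ] E)} {k : G → ℂ} {μ : Measure G} [μ.IsHaarMeasure]

theorem integrable_smul_representation (hU : ∀ f, Continuous fun g => U g f) (hk : Continuous k)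
    (hks : HasCompactSupport k) (f : E) : Integrable (fun x => k x • U x f) μ :=
  (hk.smul (hU f)).integrable_of_hasCompactSupport hks.smul_right

/-- The operator `f ↦ ∫ k(x) U(x) f dx` attached to a strongly continuous unitary representation
`U` and a continuous function `k` of compact support. -/
noncomputable def smoothingOperator (μ : Measure G) [μ.IsHaarMeasure]
    (hU : ∀ f, Continuous fun g => U g f) (hk : Continuous k)
    (hks : HasCompactSupport k) : E →L[ℂ] E :=
  LinearMap.mkContinuous
    { toFun := fun f => ∫ x, k x • U x f ∂μ
      map_add' := fun f f' => by
        rw [← integral_add (integrable_smul_representation hU hk hks f)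
          (integrable_smul_representation hU hk hks f')]
        simp
      map_smul' := fun c f => by
        rw [RingHom.id_apply, ← integral_smul]
        simp [smul_comm c] } (∫ x, ‖k x‖ ∂μ) fun f => by
    refine (norm_integral_le_integral_norm _).trans_eq ?_
    rw [← integral_mul_const]
    simp [norm_smul]

theorem smoothingOperator_apply (hU : ∀ f, Continuous fun g => U g f) (hk : Continuous k)
    (hks : HasCompactSupport k) (f : E) :
    smoothingOperator μ hU hk hks f = ∫ x, k x • U x f ∂μ := rfl

/-- The adjoint of `U x` is `U x⁻¹`, so the substitution `x ↦ x⁻¹` turns the adjoint into the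
operator with kernel `star (k x⁻¹) = k x`. -/
theorem smoothingOperator_isSelfAdjoint (hU : ∀ f, Continuous fun g => U g f) (hk : Continuous k)
    (hks : HasCompactSupport k) (hsymm : ∀ x, k x⁻¹ = star (k x)) [μ.IsInvInvariant] :
    IsSelfAdjoint (smoothingOperator μ hU hk hks) := by
  rw [ContinuousLinearMap.isSelfAdjoint_iff_isSymmetric]
  intro f f'
  simp only [ContinuousLinearMap.coe_coe, smoothingOperator_apply]
  rw [← inner_conj_symm, ← integral_inner (integrable_smul_representation hU hk hks f),
    ← integral_inner (integrable_smul_representation hU hk hks f'), ← integral_conj,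
    ← integral_inv_eq_self]
  refine integral_congr_ae (Filter.Eventually.of_forall fun x => ?_)
  have hx : U x (U x⁻¹ f) = f := by rw [map_inv]; exact (U x).apply_symm_apply f
  simp only [inner_smul_right, hsymm]
  rw [← (U x).inner_map_map, hx]
  simp

/-- Absorbing `U g` into a translate of the kernel bounds the variation of `U g * K` in operator
norm by an `L¹` distance between translates of `k`. -/
theorem representation_smoothingOperator (hU : ∀ f, Continuous fun g => U g f) (hk : Continuous k)
    (hks : HasCompactSupport k) (g : G) (f : E) :
    U g (smoothingOperator μ hU hk hks f) = ∫ x, k (g⁻¹ * x) • U x f ∂μ := by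
  rw [smoothingOperator_apply, ← integral_mul_left_eq_self (fun x => k (g⁻¹ * x) • U x f) g]
  have := (U g).toContinuousLinearEquiv.toContinuousLinearMap.integral_comp_comm
    (integrable_smul_representation (μ := μ) hU hk hks f)
  refine this.symm.trans (integral_congr_ae (Filter.Eventually.of_forall fun x => ?_))
  simp

theorem representation_comm_smoothingOperator (hU : ∀ f, Continuous fun g => U g f)
    (hk : Continuous k) (hks : HasCompactSupport k) (g : G) (f : E) :
    U g (smoothingOperator μ hU hk hks f) = smoothingOperator μ hU hk hks (U g f) := by
  rw [smoothingOperator_apply]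
  have := (U g).toContinuousLinearEquiv.toContinuousLinearMap.integral_comp_comm
    (integrable_smul_representation (μ := μ) hU hk hks f)
  refine this.symm.trans (integral_congr_ae (Filter.Eventually.of_forall fun x => ?_))
  have hx : U g (U x f) = U x (U g f) :=
    DFunLike.congr_fun (((Commute.all g x).map U).eq : U g * U x = U x * U g) f
  simp [hx]

theorem continuous_integral_norm_translate_sub (hk : Continuous k) (hks : HasCompactSupport k)
    (h : G) : ContinuousAt (fun g => ∫ x, ‖k (g⁻¹ * x) - k (h⁻¹ * x)‖ ∂μ) h := by
  obtain ⟨N, hN, hNh⟩ := exists_compact_mem_nhds h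
  refine (continuousOn_integral_of_compact_support (hN.mul hks) (s := N) (f := fun g x =>
    ‖k (g⁻¹ * x) - k (h⁻¹ * x)‖) ?_ ?_).continuousAt hNh
  · exact Continuous.continuousOn (by fun_prop)
  · intro g x hg hx
    have key : ∀ g ∈ N, k (g⁻¹ * x) = 0 := fun g hg => by
      by_contra hne
      exact hx ⟨g, hg, g⁻¹ * x, subset_tsupport _ hne, by simp⟩
    simp [key g hg, key h (mem_of_mem_nhds hNh)]

/-- A Urysohn bump multiplied by its reflection is symmetric; dividing by its positive integral
normalises it. -/
theorem exists_symmetric_approximate_unit [T2Space G] {W : Set G} (hW : W ∈ 𝓝 (1 : G)) :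
    ∃ k : G → ℂ, Continuous k ∧ HasCompactSupport k ∧ (∀ x, k x⁻¹ = star (k x)) ∧
      (∀ x ∉ W, k x = 0) ∧ (∫ x, k x ∂μ = 1) ∧ ∫ x, ‖k x‖ ∂μ = 1 := by
  obtain ⟨f, hf1, hf0, hfs, hf⟩ := exists_continuous_one_zero_of_isCompact
    (isCompact_singleton (x := (1 : G))) (isClosed_compl_iff.2 (isOpen_interior (s := W)))
    (by simpa using mem_interior_iff_mem_nhds.2 hW)
  let h : G → ℝ := fun x => f x * f x⁻¹
  have hh : Continuous h := by fun_prop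
  have hhs : HasCompactSupport h := hfs.mul_right
  have hh0 : 0 ≤ h := fun x => mul_nonneg (hf x).1 (hf _).1
  have hpos : 0 < ∫ x, h x ∂μ :=
    hh.integral_pos_of_hasCompactSupport_nonneg_nonzero hhs hh0 (x := 1) (by
      have : f 1 = 1 := hf1 rfl
      simp [h, this])
  set c := ∫ x, h x ∂μ with hc
  have hk : ∀ x, ‖((h x / c : ℝ) : ℂ)‖ = h x / c := fun x => by
    rw [Complex.norm_real, Real.norm_of_nonneg (div_nonneg (hh0 x) hpos.le)]
  have hone : ∫ x, h x / c ∂μ = 1 := by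
    rw [integral_div, ← hc, div_self hpos.ne']
  refine ⟨fun x => ((h x / c : ℝ) : ℂ), by fun_prop, ?_, fun x => ?_, fun x hx => ?_, ?_, ?_⟩
  · exact hhs.comp_left (g := fun y : ℝ => ((y / c : ℝ) : ℂ)) (by simp)
  · simp [h, mul_comm]
  · have : f x = 0 := hf0 (fun hx' => hx (interior_subset hx'))
    simp [h, this]
  · rw [integral_complex_ofReal, hone, Complex.ofReal_one]
  · simp_rw [hk, hone]

/-- For a strongly continuous unitary representation of a locally compact abelian group, an element
that acts nontrivially is detected by a continuous character. -/
theorem exists_continuous_character_of_representation [T2Space G]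
    (hU : ∀ f, Continuous fun g => U g f) {c : G} {f : E} (hf : U c f ≠ f) :
    ∃ χ : G →* Circle, Continuous χ ∧ χ c ≠ 1 := by
  let μ : Measure G := Measure.haar
  let ε := ‖U c f - f‖ / 2
  have hε : 0 < ε := half_pos (norm_pos_iff.2 (sub_ne_zero.2 hf))
  have hW : {x | ‖U x f - f‖ < ε / 2} ∈ 𝓝 (1 : G) := by
    refine ((hU f).sub continuous_const).norm.continuousAt.eventually_lt_const ?_
    simpa using half_pos hε
  obtain ⟨k, hk, hks, hsymm, hkW, hk1, hkn⟩ := exists_symmetric_approximate_unit (μ := μ) hW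
  let K := smoothingOperator μ hU hk hks
  have hKf : ‖K f - f‖ ≤ ε / 2 := by
    have h1 : K f - f = ∫ x, k x • (U x f - f) ∂μ := by
      have h2 : ∫ x, k x • f ∂μ = f := by rw [integral_smul_const, hk1, one_smul]
      simp_rw [smul_sub]
      rw [integral_sub (integrable_smul_representation hU hk hks f)
        ((hk.integrable_of_hasCompactSupport hks).smul_const f), h2]
      rfl
    rw [h1]
    refine (norm_integral_le_of_norm_le (g := fun x => ‖k x‖ * (ε / 2))
      ((hk.integrable_of_hasCompactSupport hks).norm.mul_const _)
      (Filter.Eventually.of_forall fun x => ?_)).trans_eq ?_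
    · rw [norm_smul]
      by_cases hx : x ∈ {x | ‖U x f - f‖ < ε / 2}
      · exact mul_le_mul_of_nonneg_left (le_of_lt hx) (norm_nonneg _)
      · simp [hkW x hx]
    · rw [integral_mul_const, hkn, one_mul]
  let V : G →* unitary (E →L[ℂ] E) := Unitary.linearIsometryEquiv.symm.toMonoidHom.comp U
  have hV : ∀ g f, (V g : E →L[ℂ] E) f = U g f := fun g f => rfl
  refine exists_continuous_character_of_unitary V K
    (smoothingOperator_isSelfAdjoint hU hk hks hsymm) (fun g => ?_) ?_ (fun h => ?_)
  · ext f
    exact representation_comm_smoothingOperator hU hk hks g f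
  · rw [continuous_iff_continuousAt]
    intro h
    rw [ContinuousAt, tendsto_iff_norm_sub_tendsto_zero]
    have h0 := continuous_integral_norm_translate_sub (μ := μ) hk hks h
    rw [ContinuousAt] at h0
    simp only [sub_self, norm_zero, integral_zero] at h0
    refine squeeze_zero (fun _ => norm_nonneg _) (fun g => ?_) h0
    refine ContinuousLinearMap.opNorm_le_bound _ (integral_nonneg fun _ => norm_nonneg _) fun f => ?_
    have hi : ∀ g, Integrable (fun x => k (g⁻¹ * x) • U x f) μ := fun g =>
      Continuous.integrable_of_hasCompactSupport (by have := hU f; fun_prop)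
        (hks.comp_homeomorph (Homeomorph.mulLeft g⁻¹)).smul_right
    have : ((V g : E →L[ℂ] E) * K - (V h : E →L[ℂ] E) * K) f =
        ∫ x, (k (g⁻¹ * x) - k (h⁻¹ * x)) • U x f ∂μ := by
      simp_rw [sub_smul]
      rw [integral_sub (hi g) (hi h)]
      exact congrArg₂ _ (representation_smoothingOperator hU hk hks g f)
        (representation_smoothingOperator hU hk hks h f)
    rw [this, ← integral_mul_const]
    refine (norm_integral_le_integral_norm _).trans_eq ?_
    simp [norm_smul]
  · have h1 : U c (K f) = K f := DFunLike.congr_fun h f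
    -- If `U c` fixed `K f`, then `f` would move by at most `2 * ‖K f - f‖ ≤ ε`, which is half its
    -- actual displacement.
    have h2 : U c f - f = (K f - f) - U c (K f - f) := by
      rw [map_sub, h1]; abel
    have h3 : ‖U c f - f‖ ≤ ε / 2 + ε / 2 := by
      rw [h2]
      refine (norm_sub_le _ _).trans (add_le_add hKf ?_)
      rwa [LinearIsometryEquiv.norm_map]
    have : ‖U c f - f‖ = 2 * ε := by simp only [ε]; ring
    linarith

end UnitaryRepresentation

/-! ### Separation of points by characters -/

section GelfandRaikov

open MeasureTheory Topology DomMulAct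

/-- Continuous characters separate the points of a locally compact abelian group. -/
theorem exists_continuous_character_ne_one {G : Type*} [CommGroup G] [TopologicalSpace G]
    [IsTopologicalGroup G] [LocallyCompactSpace G] [T2Space G] {c : G} (hc : c ≠ 1) :
    ∃ χ : G →* Circle, Continuous χ ∧ χ c ≠ 1 := by
  let _ : MeasurableSpace G := borel G
  have _ : BorelSpace G := ⟨rfl⟩
  let μ : Measure G := Measure.haar
  have _ : Fact ((2 : ENNReal) ≠ ⊤) := ⟨by simp⟩
  let T : Gᵈᵐᵃ → Lp ℂ 2 μ →ₗᵢ[ℂ] Lp ℂ 2 μ := fun g =>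
    { toFun := fun f => g • f
      map_add' := smul_add g
      map_smul' := fun c f => smul_comm g c f
      norm_map' := norm_smul_Lp g }
  let U : G →* (Lp ℂ 2 μ ≃ₗᵢ[ℂ] Lp ℂ 2 μ) :=
    { toFun := fun g => LinearIsometryEquiv.ofSurjective (T (mk g)) fun f =>
        ⟨(mk g)⁻¹ • f, smul_inv_smul (mk g) f⟩
      map_one' := by
        ext1 f
        exact one_smul Gᵈᵐᵃ f
      map_mul' := fun g h => by
        ext1 f
        change mk (g * h) • f = mk g • mk h • f
        -- Translation in the argument reverses products; commutativity makes it a homomorphism.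
        rw [mul_comm, mk_mul, mul_smul] }
  have hU : ∀ f, Continuous fun g => U g f := fun f =>
    show Continuous fun g => mk g • f from
      (DomMulAct.continuous_mk).smul continuous_const
  -- Translation by `c` moves this bump, as is seen at the point `1`: continuity and full support of
  -- Haar measure turn a.e. equality into equality.
  obtain ⟨f, hf1, hf0, hfs, -⟩ := exists_continuous_one_zero_of_isCompact
    (isCompact_singleton (x := (1 : G))) (isClosed_singleton (x := c)) (by simpa using hc.symm)
  let F : G → ℂ := fun x => f x
  have hF : Continuous F := by fun_prop
  have hFs : HasCompactSupport F := hfs.comp_left (g := fun y : ℝ => (y : ℂ)) (by simp)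
  have hL : MemLp F 2 μ := hF.memLp_of_hasCompactSupport hFs
  refine exists_continuous_character_of_representation hU (c := c) (f := hL.toLp F) fun h => ?_
  have h1 : mk c • hL.toLp F = hL.toLp F := h
  rw [mk_smul_toLp, MemLp.toLp_eq_toLp_iff, Continuous.ae_eq_iff_eq μ (by fun_prop) hF] at h1
  have h2 := congrFun h1 1
  have h3 : f 1 = 1 := hf1 rfl
  have h4 : f c = 0 := hf0 rfl
  simp [F, h3, h4] at h2

/-- Continuous characters separate the points of an additive locally compact abelian group. -/
theorem exists_continuous_addCharacter_ne_one {G : Type*} [AddCommGroup G] [TopologicalSpace G]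
    [IsTopologicalAddGroup G] [LocallyCompactSpace G] [T2Space G] {c : G} (hc : c ≠ 0) :
    ∃ χ : Multiplicative G →* Circle, Continuous (fun g : G => χ (.ofAdd g)) ∧
      χ (.ofAdd c) ≠ 1 := by
  have _ : LocallyCompactSpace (Multiplicative G) := ‹LocallyCompactSpace G›
  have _ : T2Space (Multiplicative G) := ‹T2Space G›
  obtain ⟨χ, h, h'⟩ := exists_continuous_character_ne_one (c := Multiplicative.ofAdd c)
    (by simpa using hc)
  exact ⟨χ, h.comp continuous_ofAdd, h'⟩

end GelfandRaikov

/-! ### Adjoining one element to a closed subgroup -/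

section CyclicDichotomy

open Topology

variable {G : Type*} [AddCommGroup G] [TopologicalSpace G] [IsTopologicalAddGroup G]
  {H : AddSubgroup G} {g : G}

/-- Returns sufficiently close to `H` stay close after multiplication by `±(N + 1)`, which makes a
nonzero return time positive and larger than `N`. -/
theorem exists_nsmul_sub_mem_of_recurrent
    (hr : ∀ V ∈ 𝓝 (0 : G), ∃ n : ℤ, n ≠ 0 ∧ ∃ h ∈ H, n • g - h ∈ V) {V : Set G}
    (hV : V ∈ 𝓝 (0 : G)) (N : ℕ) : ∃ n : ℕ, N < n ∧ ∃ h ∈ H, n • g - h ∈ V := by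
  have h1 : Filter.Tendsto (fun x : G => (N + 1) • x) (𝓝 0) (𝓝 0) := by
    simpa using (continuous_nsmul (M := G) (N + 1)).tendsto 0
  have h2 : Filter.Tendsto (fun x : G => -((N + 1) • x)) (𝓝 0) (𝓝 0) := by
    simpa using h1.neg
  obtain ⟨n, hn, h, hh, hnW⟩ := hr _ (Filter.inter_mem (h1 hV) (h2 hV))
  rcases le_total 0 n with hn0 | hn0
  · lift n to ℕ using hn0
    refine ⟨(N + 1) * n, ?_, (N + 1) • h, H.nsmul_mem hh _, ?_⟩
    · have : 0 < n := by omega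
      nlinarith
    · have := hnW.1
      simpa [mul_smul, smul_sub] using this
  · obtain ⟨m, rfl⟩ := Int.exists_eq_neg_ofNat hn0
    refine ⟨(N + 1) * m, ?_, -((N + 1) • h), H.neg_mem (H.nsmul_mem hh _), ?_⟩
    · have : 0 < m := by omega
      nlinarith
    · have := hnW.2
      rw [Set.mem_preimage] at this
      convert this using 1
      simp only [mul_smul, neg_smul, natCast_zsmul, smul_sub, smul_neg]
      abel

/-- If multiples of `g` return to every neighbourhood of `H`, then the closure of `H + ℤ g` is
contained in `H + B` for some compact set `B`. -/
theorem exists_compact_of_recurrent [LocallyCompactSpace G]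
    (hr : ∀ V ∈ 𝓝 (0 : G), ∃ n : ℤ, n ≠ 0 ∧ ∃ h ∈ H, n • g - h ∈ V) :
    ∃ B : Set G, IsCompact B ∧
      ∀ x ∈ (H ⊔ AddSubgroup.zmultiples g).topologicalClosure, ∃ h ∈ H, x - h ∈ B := by
  set S := (H ⊔ AddSubgroup.zmultiples g).topologicalClosure with hS
  have hHS : ∀ h ∈ H, h ∈ S := fun h hh =>
    AddSubgroup.le_topologicalClosure _ (AddSubgroup.mem_sup_left hh)
  have hgS : ∀ n : ℕ, n • g ∈ S := fun n => S.nsmul_mem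
    (AddSubgroup.le_topologicalClosure _
      (AddSubgroup.mem_sup_right (AddSubgroup.mem_zmultiples g))) n
  -- Approximate `x` by `h0 + m • g` and add a return time larger than `|m|`, so that the total
  -- multiple of `g` is positive.
  have claim : ∀ x ∈ S, ∀ V ∈ 𝓝 (0 : G), ∃ n : ℕ, 1 ≤ n ∧ ∃ h ∈ H, n • g - x - h ∈ V := by
    intro x hx V hV
    obtain ⟨W, hW, hWV⟩ := exists_nhds_zero_half hV
    have hx' : x ∈ closure ((H ⊔ AddSubgroup.zmultiples g : AddSubgroup G) : Set G) := hx
    have hN : {y | y - x ∈ W} ∈ 𝓝 x := by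
      have : Filter.Tendsto (fun y => y - x) (𝓝 x) (𝓝 0) := by
        simpa using (continuous_sub_right x).tendsto x
      exact this hW
    obtain ⟨y, hyW, hy⟩ := mem_closure_iff_nhds.1 hx' _ hN
    obtain ⟨h0, hh0, z, hz, rfl⟩ := AddSubgroup.mem_sup.1 hy
    obtain ⟨m, rfl⟩ := AddSubgroup.mem_zmultiples_iff.1 hz
    obtain ⟨n, hn, h, hh, hnW⟩ := exists_nsmul_sub_mem_of_recurrent hr hW m.natAbs
    obtain ⟨k, hk⟩ := Int.eq_ofNat_of_zero_le (a := n + m) (by omega)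
    refine ⟨k, by omega, h - h0, H.sub_mem hh hh0, ?_⟩
    have : k • g = n • g + m • g := by
      rw [← natCast_zsmul, ← natCast_zsmul, ← add_smul, hk]
    rw [this]
    convert hWV _ hyW _ hnW using 1
    abel
  obtain ⟨U, hU, hU0⟩ := exists_compact_mem_nhds (0 : G)
  -- For `u` in `O m`, subtracting `m • g` returns `u` to `U` modulo `H`. Compactness bounds the `m`
  -- that are needed. Thus the least positive `n` with `n • g - x` in `U` modulo `H` obeys the same
  -- bound: otherwise `n - m` would be a smaller one.
  let O : ℕ → Set G := fun n => ⋃ h ∈ H, {u | 1 ≤ n ∧ -(n • g - u - h) ∈ interior U}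
  have hO : ∀ n, IsOpen (O n) := fun n => isOpen_biUnion fun h _ =>
    isOpen_const.inter (isOpen_interior.preimage (by fun_prop))
  have hcover : U ∩ S ⊆ ⋃ n, O n := by
    rintro u ⟨-, hu⟩
    have hV : {v : G | -v ∈ interior U} ∈ 𝓝 (0 : G) := by
      refine (isOpen_interior.preimage continuous_neg).mem_nhds ?_
      simpa using mem_interior_iff_mem_nhds.2 hU0
    obtain ⟨n, hn, h, hh, hv⟩ := claim u hu _ hV
    exact Set.mem_iUnion.2 ⟨n, Set.mem_biUnion hh ⟨hn, hv⟩⟩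
  obtain ⟨t, ht⟩ := (hU.inter_right
    (AddSubgroup.isClosed_topologicalClosure _ : IsClosed (S : Set G))).elim_finite_subcover O hO
    hcover
  refine ⟨⋃ n ∈ Finset.range (t.sup id + 1), (fun u => n • g - u) '' U,
    Finset.isCompact_biUnion _ fun n _ => hU.image (by fun_prop), fun x hx => ?_⟩
  classical
  have hex := claim x hx U hU0
  obtain ⟨hn, h, hh, hu⟩ := Nat.find_spec hex
  set n := Nat.find hex with hn_def
  have huS : n • g - x - h ∈ S := S.sub_mem (S.sub_mem (hgS n) hx) (hHS h hh)
  have hle : n ≤ t.sup id := by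
    obtain ⟨m, hm, hum⟩ := Set.mem_iUnion₂.1 (ht ⟨hu, huS⟩)
    obtain ⟨h', hh', hm1, hv⟩ := Set.mem_iUnion₂.1 hum
    by_contra! hlt
    have hmt : m ≤ t.sup id := Finset.le_sup (f := id) hm
    refine Nat.find_min hex (m := n - m) (by omega) ⟨by omega, h - h', H.sub_mem hh hh', ?_⟩
    convert interior_subset hv using 1
    rw [sub_nsmul _ (by omega : m ≤ n)]
    abel
  refine ⟨-h, H.neg_mem hh, Set.mem_biUnion (Finset.mem_coe.2 (Finset.mem_range.2
    (Nat.lt_succ_of_le hle))) ⟨n • g - x - h, hu, ?_⟩⟩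
  change n • g - (n • g - x - h) = x - -h
  abel

theorem eq_zero_of_zsmul_mem_of_discrete {V : Set G} (hV : V ∈ 𝓝 (0 : G))
    (hd : ∀ n : ℤ, n ≠ 0 → ∀ h ∈ H, n • g - h ∉ V) {n : ℤ} (hn : n • g ∈ H) : n = 0 := by
  by_contra hne
  exact hd n hne _ hn (by simpa using mem_of_mem_nhds hV)

theorem mem_of_mem_sup_zmultiples_of_discrete {V : Set G}
    (hd : ∀ n : ℤ, n ≠ 0 → ∀ h ∈ H, n • g - h ∉ V) {x : G}
    (hx : x ∈ H ⊔ AddSubgroup.zmultiples g) (hxV : x ∈ V) : x ∈ H := by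
  obtain ⟨h, hh, z, hz, rfl⟩ := AddSubgroup.mem_sup.1 hx
  obtain ⟨n, rfl⟩ := AddSubgroup.mem_zmultiples_iff.1 hz
  rcases eq_or_ne n 0 with rfl | hn
  · simpa using hh
  · exact absurd (by simpa [add_comm] using hxV) (hd n hn (-h) (H.neg_mem hh))

/-- A subgroup that coincides near `0` with a closed subgroup is closed. -/
theorem AddSubgroup.isClosed_of_inter_nhds_subset {S : AddSubgroup G} (hH : IsClosed (H : Set G))
    (hHS : H ≤ S) {V : Set G} (hV : V ∈ 𝓝 (0 : G)) (h : ∀ x ∈ S, x ∈ V → x ∈ H) :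
    IsClosed (S : Set G) := by
  refine isClosed_of_closure_subset fun x hx => ?_
  have hsub : Filter.Tendsto (fun p : G × G => p.1 - p.2) (𝓝 x ×ˢ 𝓝 x) (𝓝 0) := by
    rw [← nhds_prod_eq]
    simpa using (continuous_sub (G := G)).tendsto (x, x)
  -- Differences of points of `W` lie in `V`, so near `x` the subgroup `S` stays in one coset of
  -- `H`, which is closed.
  obtain ⟨W, hW, hWV⟩ := Filter.mem_prod_self_iff.1 (hsub hV)
  obtain ⟨s, hsW, hs⟩ := mem_closure_iff_nhds.1 hx W hW
  have hcl : IsClosed {y : G | y - s ∈ H} := hH.preimage (continuous_sub_right s)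
  have hxs : x ∈ {y : G | y - s ∈ H} := by
    rw [← hcl.closure_eq]
    refine mem_closure_iff_nhds.2 fun N hN => ?_
    obtain ⟨y, hy, hyS⟩ := mem_closure_iff_nhds.1 hx _ (Filter.inter_mem hN hW)
    exact ⟨y, hy.1, h _ (S.sub_mem hyS hs) (hWV (Set.mk_mem_prod hy.2 hsW))⟩
  simpa using S.add_mem (hHS hxs) hs

/-- With `C = B ∪ -B`, finitely many translates of `B` cover `C + C`. Each new generator can thus be
absorbed modulo the centres of these translates, which keeps the remainder in `C`. -/
theorem exists_finset_closure_subset {B : Set G} (hB : IsCompact B) (hB0 : B ∈ 𝓝 (0 : G)) :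
    ∃ F : Finset G, (F : Set G) ⊆ AddSubgroup.closure B ∧ ∃ B' : Set G, IsCompact B' ∧
      ∀ x ∈ AddSubgroup.closure B, ∃ y ∈ AddSubgroup.closure (F : Set G), x - y ∈ B' := by
  let C := B ∪ -B
  have hC : IsCompact C := hB.union hB.neg
  have hCcl : ∀ c ∈ C, c ∈ AddSubgroup.closure B := by
    rintro c (hc | hc)
    · exact AddSubgroup.subset_closure hc
    · simpa using AddSubgroup.neg_mem _ (AddSubgroup.subset_closure hc)
  obtain ⟨t, htC, ht⟩ := (hC.add hC).elim_nhds_subcover (fun x => {y | y - x ∈ B}) fun x _ => by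
    have : Filter.Tendsto (fun y => y - x) (𝓝 x) (𝓝 0) := by
      simpa using (continuous_sub_right x).tendsto x
    exact this hB0
  refine ⟨t, fun x hx => ?_, C, hC, fun x hx => ?_⟩
  · obtain ⟨a, ha, b, hb, rfl⟩ := htC x hx
    exact AddSubgroup.add_mem _ (hCcl a ha) (hCcl b hb)
  · have step : ∀ c ∈ C, ∀ x, (∃ y ∈ AddSubgroup.closure (t : Set G), x - y ∈ C) →
        ∃ y ∈ AddSubgroup.closure (t : Set G), c + x - y ∈ C := by
      rintro c hc x ⟨y, hy, hxy⟩
      obtain ⟨f, hf, hcf⟩ := Set.mem_iUnion₂.1 (ht (Set.add_mem_add hc hxy))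
      refine ⟨y + f, AddSubgroup.add_mem _ hy (AddSubgroup.subset_closure hf), Or.inl ?_⟩
      rw [Set.mem_ofPred_eq] at hcf
      convert hcf using 1
      abel
    induction hx using AddSubgroup.closure_induction_left with
    | zero => exact ⟨0, AddSubgroup.zero_mem _, Or.inl (by simpa using mem_of_mem_nhds hB0)⟩
    | add_left c hc x _ ih => exact step c (Or.inl hc) x ih
    | neg_add_cancel c hc x _ ih => exact step (-c) (Or.inr (by simpa using hc)) x ih

/-- An induction principle for closed subgroups: a property that passes to cocompact extensions and
to extensions by an open infinite cyclic group passes from `X` to `X + ⟨B⟩` for `B` a compact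
neighbourhood of `0`. -/
theorem AddSubgroup.induction_sup_closure_compact [LocallyCompactSpace G] (P : AddSubgroup G → Prop)
    (hco : ∀ H H' : AddSubgroup G, IsClosed (H : Set G) → IsClosed (H' : Set G) → H ≤ H' →
      (∃ B : Set G, IsCompact B ∧ ∀ x ∈ H', ∃ h ∈ H, x - h ∈ B) → P H → P H')
    (hcyc : ∀ (H : AddSubgroup G) (g : G), IsClosed (H : Set G) →
      IsClosed ((H ⊔ zmultiples g : AddSubgroup G) : Set G) →
      (∃ V ∈ 𝓝 (0 : G), ∀ x ∈ H ⊔ zmultiples g, x ∈ V → x ∈ H) →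
      (∀ n : ℤ, n • g ∈ H → n = 0) → P H → P (H ⊔ zmultiples g))
    {X : AddSubgroup G} (hX : IsClosed (X : Set G)) (hPX : P X) {B : Set G} (hB : IsCompact B)
    (hB0 : B ∈ 𝓝 (0 : G)) : P (X ⊔ closure B) := by
  obtain ⟨F, hF, B', hB', hFB⟩ := exists_finset_closure_subset hB hB0
  set O := X ⊔ closure B with hOdef
  have hO : IsOpen (O : Set G) := O.isOpen_of_mem_nhds (g := 0)
    (Filter.mem_of_superset hB0 fun x hx => mem_sup_right (subset_closure hx))
  have hOc : IsClosed (O : Set G) := O.isClosed_of_isOpen hO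
  have key : ∀ T : Finset G, (T : Set G) ⊆ closure B → ∃ H : AddSubgroup G,
      IsClosed (H : Set G) ∧ X ≤ H ∧ H ≤ O ∧ (T : Set G) ⊆ H ∧ P H := by
    classical
    intro T
    induction T using Finset.induction_on with
    | empty => exact fun _ => ⟨X, hX, le_rfl, le_sup_left, by simp, hPX⟩
    | insert g T _ ih =>
      intro hT
      obtain ⟨H, hH, hXH, hHO, hTH, hPH⟩ := ih fun x hx => hT (by simpa using Or.inr hx)
      have hgO : g ∈ O := mem_sup_right (hT (by simp))
      have hle : H ⊔ zmultiples g ≤ O := sup_le hHO (by simpa using hgO)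
      have hsub : ∀ S : AddSubgroup G, H ⊔ zmultiples g ≤ S →
          ((insert g T : Finset G) : Set G) ⊆ S := fun S hS x hx => by
        rcases Finset.mem_insert.1 (Finset.mem_coe.1 hx) with rfl | hx
        · exact hS (mem_sup_right (mem_zmultiples x))
        · exact hS (mem_sup_left (hTH hx))
      -- If multiples of `g` accumulate at `H`, the closure of `H + ℤ g` is cocompact over `H`;
      -- otherwise `H + ℤ g` is already closed, agrees with `H` near `0`, and the multiples of `g`
      -- are independent of `H`.
      by_cases hr : ∀ V ∈ 𝓝 (0 : G), ∃ n : ℤ, n ≠ 0 ∧ ∃ h ∈ H, n • g - h ∈ V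
      · have hc := isClosed_topologicalClosure (H ⊔ zmultiples g)
        have hl : H ≤ (H ⊔ zmultiples g).topologicalClosure :=
          le_sup_left.trans (le_topologicalClosure _)
        exact ⟨_, hc, hXH.trans hl, topologicalClosure_minimal _ hle hOc,
          hsub _ (le_topologicalClosure _), hco H _ hH hc hl (exists_compact_of_recurrent hr) hPH⟩
      · push Not at hr
        obtain ⟨V, hV, hd⟩ := hr
        have hV' : ∀ x ∈ H ⊔ zmultiples g, x ∈ V → x ∈ H := fun x hx hxV =>
          mem_of_mem_sup_zmultiples_of_discrete hd hx hxV
        have hc := isClosed_of_inter_nhds_subset hH le_sup_left hV hV'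
        exact ⟨_, hc, hXH.trans le_sup_left, hle, hsub _ le_rfl,
          hcyc H g hH hc ⟨V, hV, hV'⟩ (fun n => eq_zero_of_zsmul_mem_of_discrete hV hd) hPH⟩
  obtain ⟨H, hH, hXH, hHO, hFH, hPH⟩ := key F hF
  refine hco H O hH hOc hHO ⟨B', hB', fun x hx => ?_⟩ hPH
  obtain ⟨a, ha, b, hb, rfl⟩ := mem_sup.1 hx
  obtain ⟨y, hy, hby⟩ := hFB b hb
  refine ⟨a + y, H.add_mem (hXH ha) ((closure_le H).2 hFH hy), ?_⟩
  convert hby using 1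
  abel

end CyclicDichotomy

/-! ### Extension of real characters from closed subgroups -/

section RealExtension

open Topology

/-- Where `n • x` lies in `V`, the value at `x` is at most `C / n`. -/
theorem AddMonoidHom.continuous_of_bounded_nhds {G : Type*} [AddCommGroup G] [TopologicalSpace G]
    [IsTopologicalAddGroup G] (φ : G →+ ℝ) {V : Set G} (hV : V ∈ 𝓝 (0 : G)) {C : ℝ}
    (hC : ∀ x ∈ V, |φ x| ≤ C) : Continuous φ := by
  refine continuous_of_continuousAt_zero φ ?_
  rw [ContinuousAt, map_zero, Metric.tendsto_nhds]
  intro ε hε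
  obtain ⟨n, hn⟩ := exists_nat_gt (C / ε)
  have hC0 : 0 ≤ C := (abs_nonneg _).trans (hC 0 (mem_of_mem_nhds hV))
  have hn0 : (0 : ℝ) < n := (div_nonneg hC0 hε.le).trans_lt hn
  have ht : Filter.Tendsto (fun x : G => n • x) (𝓝 0) (𝓝 0) := by
    simpa using (continuous_nsmul (M := G) n).tendsto 0
  filter_upwards [ht hV] with x hx
  have h1 := hC _ hx
  rw [map_nsmul, nsmul_eq_mul, abs_mul, abs_of_pos hn0] at h1
  rw [Real.dist_0_eq_abs]
  rw [div_lt_iff₀ hε] at hn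
  nlinarith

theorem AddMonoidHom.eq_zero_of_bounded {G : Type*} [AddCommGroup G] (φ : G →+ ℝ) {C : ℝ}
    (hC : ∀ x, |φ x| ≤ C) (x : G) : φ x = 0 := by
  by_contra hne
  obtain ⟨n, hn⟩ := exists_nat_gt (C / |φ x|)
  have h1 := hC (n • x)
  rw [map_nsmul, nsmul_eq_mul, abs_mul, Nat.abs_cast] at h1
  rw [div_lt_iff₀ (abs_pos.2 hne)] at hn
  linarith

/-- A real function on an abelian group that is additive up to a bounded error is at bounded
distance from an additive function. -/
theorem exists_addMonoidHom_near {G : Type*} [AddCommGroup G] (ψ : G → ℝ) {C : ℝ}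
    (hC : ∀ x y, |ψ (x + y) - ψ x - ψ y| ≤ C) : ∃ φ : G →+ ℝ, ∀ x, |φ x - ψ x| ≤ C := by
  -- Hyers' homogenisation: successive terms differ by at most `C / 2 / 2 ^ n`, and the additivity
  -- defect is divided by `2 ^ n`, so the limit is additive.
  let u : G → ℕ → ℝ := fun x n => ψ (2 ^ n • x) / 2 ^ n
  have hu : ∀ x n, dist (u x n) (u x (n + 1)) ≤ C / 2 / 2 ^ n := fun x n => by
    have h1 := hC (2 ^ n • x) (2 ^ n • x)
    have h2 : u x (n + 1) - u x n =
        (ψ (2 ^ n • x + 2 ^ n • x) - ψ (2 ^ n • x) - ψ (2 ^ n • x)) / 2 / 2 ^ n := by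
      simp only [u, pow_succ, mul_smul, two_smul, smul_add]
      field_simp
      ring
    rw [dist_comm, Real.dist_eq, h2, abs_div, abs_div, abs_of_pos (by positivity : (0 : ℝ) < 2 ^ n),
      abs_two]
    gcongr
  choose L hL using fun x => cauchySeq_tendsto_of_complete (cauchySeq_of_le_geometric_two (hu x))
  have hnear : ∀ x, |L x - ψ x| ≤ C := fun x => by
    have := dist_le_of_le_geometric_two_of_tendsto₀ (hu x) (hL x)
    simpa [u, dist_comm, Real.dist_eq, abs_sub_comm] using this
  refine ⟨AddMonoidHom.mk' L fun x y => ?_, hnear⟩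
  have h0 : Filter.Tendsto (fun n : ℕ => C / 2 ^ n) Filter.atTop (𝓝 0) := by
    simpa [div_eq_mul_inv] using
      (tendsto_pow_atTop_nhds_zero_of_lt_one (r := (2 : ℝ)⁻¹) (by norm_num) (by norm_num)).const_mul C
  have h1 : Filter.Tendsto (fun n => u (x + y) n - (u x n + u y n)) Filter.atTop (𝓝 0) := by
    refine squeeze_zero_norm (fun n => ?_) h0
    have : u (x + y) n - (u x n + u y n) =
        (ψ (2 ^ n • x + 2 ^ n • y) - ψ (2 ^ n • x) - ψ (2 ^ n • y)) / 2 ^ n := by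
      simp only [u, smul_add]
      ring
    rw [this, Real.norm_eq_abs, abs_div, abs_of_pos (by positivity : (0 : ℝ) < 2 ^ n)]
    gcongr
    exact hC _ _
  have h2 := (hL (x + y)).sub ((hL x).add (hL y))
  exact sub_eq_zero.1 (tendsto_nhds_unique h2 h1)

variable {G : Type*} [AddCommGroup G] [TopologicalSpace G] [IsTopologicalAddGroup G]

theorem AddSubgroup.exists_bound_on_compact {H : AddSubgroup G} (hH : IsClosed (H : Set G))
    {φ : H →+ ℝ} (hφ : Continuous φ) {K : Set G} (hK : IsCompact K) :
    ∃ C, ∀ h : H, (h : G) ∈ K → |φ h| ≤ C :=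
  (hH.isClosedEmbedding_subtypeVal.isCompact_preimage hK).exists_bound_of_continuousOn
    hφ.continuousOn

/-- A continuous real character of a cocompact closed subgroup extends. -/
theorem AddSubgroup.exists_extension_of_cocompact [LocallyCompactSpace G] {H : AddSubgroup G}
    (hH : IsClosed (H : Set G)) {B : Set G} (hB : IsCompact B) (hHB : ∀ x, ∃ h ∈ H, x - h ∈ B)
    {φ : H →+ ℝ} (hφ : Continuous φ) : ∃ Φ : G →+ ℝ, Continuous Φ ∧ ∀ h : H, Φ h = φ h := by
  -- An arbitrary retraction onto `H` modulo `B`. Its additivity defect lies in a compact subset of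
  -- `H`, so `φ` composed with it is additive up to a bounded error.
  choose s hs hsB using hHB
  let σ : G → H := fun x => ⟨s x, hs x⟩
  obtain ⟨C, hC⟩ := exists_bound_on_compact hH hφ ((hB.add hB).add hB.neg)
  obtain ⟨D, hD⟩ := exists_bound_on_compact hH hφ hB
  obtain ⟨V, hV, hV0⟩ := exists_compact_mem_nhds (0 : G)
  obtain ⟨E, hE⟩ := exists_bound_on_compact hH hφ (hV.add hB.neg)
  obtain ⟨Φ, hΦ⟩ := exists_addMonoidHom_near (fun x => φ (σ x)) (C := C) fun x y => by
    rw [← map_sub, ← map_sub]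
    refine hC _ ⟨x - s x + (y - s y), Set.add_mem_add (hsB x) (hsB y), _,
      Set.neg_mem_neg.2 (hsB (x + y)), ?_⟩
    simp only [σ, AddSubgroup.coe_sub]
    abel
  refine ⟨Φ, Φ.continuous_of_bounded_nhds hV0 (C := C + E) fun v hv => ?_, fun h => ?_⟩
  · have h1 : |φ (σ v)| ≤ E := hE _ ⟨v, hv, _, Set.neg_mem_neg.2 (hsB v), by simp [σ]⟩
    have h2 := hΦ v
    calc |Φ v| = |(Φ v - φ (σ v)) + φ (σ v)| := by ring_nf
      _ ≤ C + E := (abs_add_le _ _).trans (add_le_add h2 h1)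
  -- On `H` the difference is additive and bounded, hence zero: the extension is exact.
  · have h0 := (Φ.comp H.subtype - φ).eq_zero_of_bounded (C := C + D) (fun h => ?_) h
    · simpa [sub_eq_zero] using h0
    · have h1 : |φ (h - σ h)| ≤ D := hD _ (hsB h)
      have h2 := hΦ h
      rw [map_sub, abs_sub_comm] at h1
      calc |(Φ.comp H.subtype - φ) h| = |(Φ h - φ (σ h)) + (φ (σ h) - φ h)| := by
            simp
        _ ≤ C + D := (abs_add_le _ _).trans (add_le_add h2 h1)

theorem AddMonoidHom.exists_extension_real {A B : Type*} [AddCommGroup A] [AddCommGroup B]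
    (i : A →+ B) (hi : Function.Injective i) (φ : A →+ ℝ) : ∃ Φ : B →+ ℝ, ∀ a, Φ (i a) = φ a := by
  obtain ⟨Φ, hΦ⟩ := (Module.Baer.of_divisible ℝ).extension_property i.toIntLinearMap
    (by exact hi) φ.toIntLinearMap
  exact ⟨Φ.toAddMonoidHom, fun a => DFunLike.congr_fun hΦ a⟩

/-- A continuous real character of an open subgroup extends. -/
theorem AddSubgroup.exists_extension_of_open {H : AddSubgroup G} (hH : (H : Set G) ∈ 𝓝 (0 : G))
    {φ : H →+ ℝ} (hφ : Continuous φ) : ∃ Φ : G →+ ℝ, Continuous Φ ∧ ∀ h : H, Φ h = φ h := by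
  obtain ⟨Φ, hΦ⟩ := AddMonoidHom.exists_extension_real H.subtype H.subtype_injective φ
  refine ⟨Φ, continuous_of_continuousAt_zero Φ ?_, hΦ⟩
  have hopen : IsOpen (H : Set G) := H.isOpen_of_mem_nhds hH
  have h1 : ContinuousAt (Φ ∘ ((↑) : H → G)) 0 :=
    (hφ.congr fun h => (hΦ h).symm).continuousAt
  exact (hopen.isOpenEmbedding_subtypeVal.continuousAt_iff (x := (0 : H))).1 h1

theorem AddSubgroup.exists_extension_of_le {H H' : AddSubgroup G} (hle : H ≤ H')
    {φ : H →+ ℝ} (hφ : Continuous φ)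
    (hext : ∀ φ' : H.addSubgroupOf H' →+ ℝ, Continuous φ' →
      ∃ Φ : H' →+ ℝ, Continuous Φ ∧ ∀ h : H.addSubgroupOf H', Φ h = φ' h) :
    ∃ Φ : H' →+ ℝ, Continuous Φ ∧ ∀ h : H, Φ (inclusion hle h) = φ h := by
  let j : H.addSubgroupOf H' →+ H :=
    (H'.subtype.comp (H.addSubgroupOf H').subtype).codRestrict H fun x => x.2
  have hj : Continuous j := Continuous.subtype_mk
    (continuous_subtype_val.comp continuous_subtype_val) _
  obtain ⟨Φ, hΦ, hext⟩ := hext (φ.comp j) (hφ.comp hj)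
  exact ⟨Φ, hΦ, fun h => hext ⟨inclusion hle h, h.2⟩⟩

theorem AddSubgroup.cocompact_addSubgroupOf {H H' : AddSubgroup G} (hle : H ≤ H')
    (hH' : IsClosed (H' : Set G)) (h : ∃ B : Set G, IsCompact B ∧ ∀ x ∈ H', ∃ h ∈ H, x - h ∈ B) :
    ∃ B : Set H', IsCompact B ∧ ∀ x, ∃ h ∈ H.addSubgroupOf H', x - h ∈ B := by
  obtain ⟨B, hB, h⟩ := h
  refine ⟨(↑) ⁻¹' B, hH'.isClosedEmbedding_subtypeVal.isCompact_preimage hB, fun x => ?_⟩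
  obtain ⟨h, hh, hx⟩ := h x x.2
  exact ⟨⟨h, hle hh⟩, hh, hx⟩

theorem AddSubgroup.isClosed_addSubgroupOf {H H' : AddSubgroup G} (hH : IsClosed (H : Set G)) :
    IsClosed (H.addSubgroupOf H' : Set H') :=
  hH.preimage continuous_subtype_val

theorem AddSubgroup.addSubgroupOf_mem_nhds {H H' : AddSubgroup G}
    (h : ∃ V ∈ 𝓝 (0 : G), ∀ x ∈ H', x ∈ V → x ∈ H) :
    (H.addSubgroupOf H' : Set H') ∈ 𝓝 (0 : H') := by
  obtain ⟨V, hV, h⟩ := h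
  refine Filter.mem_of_superset (continuous_subtype_val.tendsto (0 : H') hV) fun x hx => h x x.2 hx

/-- A continuous real character of a closed subgroup of a locally compact abelian group extends. -/
theorem AddSubgroup.exists_extension_real [LocallyCompactSpace G] {X : AddSubgroup G}
    (hX : IsClosed (X : Set G)) {φ : X →+ ℝ} (hφ : Continuous φ) :
    ∃ Φ : G →+ ℝ, Continuous Φ ∧ ∀ x : X, Φ x = φ x := by
  obtain ⟨B, hB, hB0⟩ := exists_compact_mem_nhds (0 : G)
  have ext_trans : ∀ H H' : AddSubgroup G, H ≤ H' →
      (∀ φ' : H.addSubgroupOf H' →+ ℝ, Continuous φ' →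
        ∃ Φ : H' →+ ℝ, Continuous Φ ∧ ∀ h : H.addSubgroupOf H', Φ h = φ' h) →
      (∃ h : X ≤ H, ∃ Φ : H →+ ℝ, Continuous Φ ∧ ∀ x : X, Φ (inclusion h x) = φ x) →
      ∃ h : X ≤ H', ∃ Φ : H' →+ ℝ, Continuous Φ ∧ ∀ x : X, Φ (inclusion h x) = φ x := by
    rintro H H' hle hext ⟨h, Φ, hΦ, hΦx⟩
    obtain ⟨Φ', hΦ', hΦ'x⟩ := exists_extension_of_le hle hΦ hext
    exact ⟨h.trans hle, Φ', hΦ', fun x => (hΦ'x (inclusion h x)).trans (hΦx x)⟩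
  obtain ⟨h, Φ, hΦ, hΦx⟩ := induction_sup_closure_compact
    (fun H => ∃ h : X ≤ H, ∃ Φ : H →+ ℝ, Continuous Φ ∧ ∀ x : X, Φ (inclusion h x) = φ x)
    (fun H H' hH hH' hle hB => ext_trans H H' hle fun φ' hφ' => by
      obtain ⟨B, hB, h⟩ := cocompact_addSubgroupOf hle hH' hB
      have := hH'.isClosedEmbedding_subtypeVal.locallyCompactSpace
      exact exists_extension_of_cocompact (isClosed_addSubgroupOf hH) hB h hφ')
    (fun H g _ _ hV _ => ext_trans H _ le_sup_left fun φ' hφ' =>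
      exists_extension_of_open (addSubgroupOf_mem_nhds hV) hφ')
    hX ⟨le_rfl, φ, hφ, fun x => rfl⟩ hB hB0
  obtain ⟨Φ', hΦ', hΦ'x⟩ := exists_extension_of_open (H := X ⊔ closure B)
    (Filter.mem_of_superset hB0 fun x hx => mem_sup_right (subset_closure hx)) hΦ
  exact ⟨Φ', hΦ', fun x => (hΦ'x (inclusion h x)).trans (hΦx x)⟩

end RealExtension

/-! ### Closed subgroups of real vector spaces -/

section ClosedSubgroups

open Topology

/-- A closed subgroup of a finite-dimensional real vector space containing no line is discrete. -/
theorem AddSubgroup.discreteTopology_of_no_line {E : Type*} [NormedAddCommGroup E]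
    [NormedSpace ℝ E] [FiniteDimensional ℝ E] {D : AddSubgroup E} (hD : IsClosed (D : Set E))
    (h : ∀ v : E, (∀ t : ℝ, t • v ∈ D) → v = 0) : DiscreteTopology D := by
  refine discreteTopology_of_isOpen_singleton_zero ?_
  by_contra hopen
  have hsmall : ∀ n : ℕ, ∃ d ∈ D, d ≠ 0 ∧ ‖d‖ < 1 / ((n : ℝ) + 1) := by
    by_contra! hc
    obtain ⟨n, hn⟩ := hc
    refine hopen ?_
    have : ({0} : Set D) = (↑) ⁻¹' Metric.ball (0 : E) (1 / ((n : ℝ) + 1)) := by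
      ext d
      simp only [Set.mem_singleton_iff, Set.mem_preimage, mem_ball_zero_iff]
      constructor
      · rintro rfl
        simpa using by positivity
      · intro hd
        by_contra hne
        exact absurd hd (not_lt.2 (hn d d.2 (by simpa using hne)))
    rw [this]
    exact Metric.isOpen_ball.preimage continuous_subtype_val
  choose d hdD hd0 hdn using hsmall
  have hpos : ∀ n, 0 < ‖d n‖ := fun n => norm_pos_iff.2 (hd0 n)
  have hlim : Filter.Tendsto (fun n => ‖d n‖) Filter.atTop (𝓝 0) :=
    squeeze_zero (fun n => norm_nonneg _) (fun n => (hdn n).le) tendsto_one_div_add_atTop_nhds_zero_nat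
  have hsph : ∀ n, (‖d n‖⁻¹ • d n) ∈ Metric.sphere (0 : E) 1 := fun n => by
    rw [mem_sphere_zero_iff_norm, norm_smul, norm_inv, norm_norm, inv_mul_cancel₀ (hpos n).ne']
  have := FiniteDimensional.proper_real E
  obtain ⟨w, hw, ψ, hψ, hψw⟩ := (isCompact_sphere (0 : E) 1).tendsto_subseq hsph
  -- The limit direction `w` of small elements of `D` spans a line in `D`: the multiple `⌊t / ‖d‖⌋ •
  -- d` tends to `t • w`.
  have hw0 : w = 0 := h w fun t => by
    have h1 : Filter.Tendsto (fun n => ‖d (ψ n)‖) Filter.atTop (𝓝 0) := hlim.comp hψ.tendsto_atTop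
    have h2 : Filter.Tendsto (fun n => (⌊t / ‖d (ψ n)‖⌋ : ℝ) * ‖d (ψ n)‖) Filter.atTop (𝓝 t) := by
      have h3 : Filter.Tendsto (fun n => t - ‖d (ψ n)‖) Filter.atTop (𝓝 t) := by
        simpa using tendsto_const_nhds.sub h1
      refine tendsto_of_tendsto_of_tendsto_of_le_of_le h3 tendsto_const_nhds (fun n => ?_)
        fun n => ?_
      · have h4 := (Int.lt_floor_add_one (t / ‖d (ψ n)‖)).le
        rw [div_le_iff₀ (hpos _)] at h4
        change t - ‖d (ψ n)‖ ≤ _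
        linarith
      · exact (le_div_iff₀ (hpos _)).1 (Int.floor_le _)
    refine hD.mem_of_tendsto (h2.smul hψw) (Filter.Eventually.of_forall fun n => ?_)
    change ((⌊t / ‖d (ψ n)‖⌋ : ℝ) * ‖d (ψ n)‖) • ‖d (ψ n)‖⁻¹ • d (ψ n) ∈ D
    rw [smul_smul, mul_assoc, mul_inv_cancel₀ (hpos _).ne', mul_one, Int.cast_smul_eq_zsmul]
    exact D.zsmul_mem (hdD _) _
  rw [hw0] at hw
  simp at hw

/-- A closed subgroup of a finite-dimensional real vector space that is mapped onto `ℝ` by a linear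
form contains a line that is mapped onto `ℝ`. -/
theorem AddSubgroup.exists_line_of_surjective {E : Type*} [NormedAddCommGroup E]
    [NormedSpace ℝ E] [FiniteDimensional ℝ E] {D : AddSubgroup E} (hD : IsClosed (D : Set E))
    (ℓ : E →ₗ[ℝ] ℝ) (hℓ : ∀ t, ∃ d ∈ D, ℓ d = t) : ∃ v, ℓ v = 1 ∧ ∀ t : ℝ, t • v ∈ D := by
  let V : Submodule ℝ E :=
    { carrier := {v | ∀ t : ℝ, t • v ∈ D}
      add_mem' := fun {v w} hv hw t => by
        rw [smul_add]
        exact D.add_mem (hv t) (hw t)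
      zero_mem' := fun t => by
        rw [smul_zero]
        exact D.zero_mem
      smul_mem' := fun c v hv t => by
        rw [smul_smul]
        exact hv _ }
  by_cases hV : ∃ v ∈ V, ℓ v ≠ 0
  · obtain ⟨v, hv, hne⟩ := hV
    refine ⟨(ℓ v)⁻¹ • v, by simp [hne], fun t => ?_⟩
    rw [smul_smul]
    exact hv _
  · push Not at hV
    exfalso
    -- `V` is the largest subspace inside `D`, so `D ∩ W` contains no line and is discrete, hence
    -- countable. As `ℓ` kills `V`, this countable set would map onto `ℝ`.
    obtain ⟨W, hW⟩ := V.exists_isCompl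
    let D' : AddSubgroup E := D ⊓ W.toAddSubgroup
    have hD' : IsClosed (D' : Set E) := hD.inter W.closed_of_finiteDimensional
    have hdisc : DiscreteTopology D' := discreteTopology_of_no_line hD' fun v hv =>
      Submodule.disjoint_def.1 hW.disjoint v (fun t => (hv t).1) (by simpa using (hv 1).2)
    have := FiniteDimensional.proper_real E
    have hcount : Countable D' := countable_of_Lindelof_of_discrete
    have hsurj : Function.Surjective fun d : D' => ℓ d := fun t => by
      obtain ⟨d, hd, rfl⟩ := hℓ t
      obtain ⟨v, hv, w, hw, rfl⟩ : ∃ v ∈ V, ∃ w ∈ W, v + w = d :=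
        Submodule.mem_sup.1 (by rw [hW.sup_eq_top]; trivial)
      have hvD : v ∈ D := by simpa using hv 1
      refine ⟨⟨w, ?_, hw⟩, by simp [hV v hv]⟩
      simpa using D.sub_mem hd hvD
    exact not_countable_iff.2 (inferInstance : Uncountable ℝ) hsurj.countable

end ClosedSubgroups

/-! ### Proper homomorphisms to real vector spaces -/

section ProperCharacters

open Topology

/-- There are finitely many continuous homomorphisms to `ℝ` that together form a proper map. -/
def HasProperRealCharacters (G : Type*) [AddCommGroup G] [TopologicalSpace G] : Prop :=
  ∃ (ι : Type) (_ : Fintype ι) (Φ : ι → G →+ ℝ), (∀ i, Continuous (Φ i)) ∧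
    ∀ r : ℝ, IsCompact {x | ∀ i, |Φ i x| ≤ r}

theorem HasProperRealCharacters.of_equiv {G G' : Type*} [AddCommGroup G] [TopologicalSpace G]
    [AddCommGroup G'] [TopologicalSpace G'] (e : G ≃ₜ+ G') (h : HasProperRealCharacters G) :
    HasProperRealCharacters G' := by
  obtain ⟨ι, hι, Φ, hΦ, hc⟩ := h
  refine ⟨ι, hι, fun i => (Φ i).comp e.symm.toAddEquiv.toAddMonoidHom,
    fun i => (hΦ i).comp e.symm.continuous, fun r => ?_⟩
  exact e.symm.toHomeomorph.isCompact_preimage.2 (hc r)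

theorem HasProperRealCharacters.addSubgroupOf {G : Type*} [AddCommGroup G] [TopologicalSpace G]
    {H H' : AddSubgroup G} (hle : H ≤ H') (h : HasProperRealCharacters H) :
    HasProperRealCharacters (H.addSubgroupOf H') :=
  h.of_equiv
    { (AddSubgroup.addSubgroupOfEquivOfLe hle).symm with
      continuous_toFun := Continuous.subtype_mk (Continuous.subtype_mk continuous_subtype_val _) _
      continuous_invFun := Continuous.subtype_mk
        (continuous_subtype_val.comp continuous_subtype_val) _ }

variable {G : Type*} [AddCommGroup G] [TopologicalSpace G] [IsTopologicalAddGroup G]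

theorem isClosed_setOf_forall_abs_le {ι : Type*} {Φ : ι → G →+ ℝ} (hΦ : ∀ i, Continuous (Φ i))
    (r : ℝ) : IsClosed {x | ∀ i, |Φ i x| ≤ r} := by
  rw [Set.ofPred_forall]
  exact isClosed_iInter fun i => isClosed_le (hΦ i).abs continuous_const

/-- The extended characters are bounded on `B`, so their sublevel sets lie in a sublevel set of `H`
plus `B`. -/
theorem HasProperRealCharacters.of_cocompact [LocallyCompactSpace G] {H : AddSubgroup G}
    (hH : IsClosed (H : Set G)) {B : Set G} (hB : IsCompact B) (hHB : ∀ x, ∃ h ∈ H, x - h ∈ B)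
    (h : HasProperRealCharacters H) : HasProperRealCharacters G := by
  obtain ⟨ι, hι, Φ, hΦ, hc⟩ := h
  choose Ψ hΨ hΨΦ using fun i => AddSubgroup.exists_extension_of_cocompact hH hB hHB (hΦ i)
  choose C hC using fun i => hB.exists_bound_of_continuousOn (hΨ i).continuousOn
  obtain ⟨M, hM⟩ := (Set.finite_range C).bddAbove
  refine ⟨ι, hι, Ψ, hΨ, fun r => ?_⟩
  refine (((hc (r + M)).image continuous_subtype_val).add hB).of_isClosed_subset
    (isClosed_setOf_forall_abs_le hΨ r) fun x hx => ?_
  obtain ⟨h, hh, hxB⟩ := hHB x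
  refine ⟨h, ⟨⟨h, hh⟩, fun i => ?_, rfl⟩, x - h, hxB, add_sub_cancel h x⟩
  have h1 : |Ψ i (x - h)| ≤ M := (hC i _ hxB).trans (hM ⟨i, rfl⟩)
  have h2 : Φ i ⟨h, hh⟩ = Ψ i x - Ψ i (x - h) := by rw [← hΨΦ, map_sub]; simp
  rw [h2]
  exact (abs_sub _ _).trans (add_le_add (hx i) h1)

/-- The coefficient of `g` is one more real character, continuous because it vanishes on the
neighbourhood `H`. Bounding it leaves finitely many translates of a compact subset of `H`. -/
theorem HasProperRealCharacters.of_cyclic {H : AddSubgroup G} (hH : (H : Set G) ∈ 𝓝 (0 : G)) {g : G}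
    (hg : ∀ x, ∃ h ∈ H, ∃ n : ℤ, x = h + n • g) (hg0 : ∀ n : ℤ, n • g ∈ H → n = 0)
    (h : HasProperRealCharacters H) : HasProperRealCharacters G := by
  obtain ⟨ι, hι, Φ, hΦ, hc⟩ := h
  choose Ψ hΨ hΨΦ using fun i => AddSubgroup.exists_extension_of_open hH (hΦ i)
  choose p hp m hpm using hg
  have huniq : ∀ a ∈ H, ∀ n : ℤ, ∀ x, x = a + n • g → m x = n := fun a ha n x hx => by
    refine sub_eq_zero.1 (hg0 _ ?_)
    have : (m x - n) • g = a - p x := by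
      rw [sub_smul, sub_eq_sub_iff_add_eq_add, add_comm, ← hpm, hx, add_comm]
    rw [this]
    exact H.sub_mem ha (hp x)
  let θ : G →+ ℝ := AddMonoidHom.mk' (fun x => (m x : ℝ)) fun x y => by
    rw [huniq (p x + p y) (H.add_mem (hp x) (hp y)) (m x + m y) (x + y), Int.cast_add]
    conv_lhs => rw [hpm x, hpm y]
    rw [add_smul]
    abel
  have hθ : Continuous θ := θ.continuous_of_bounded_nhds hH (C := 0) fun x hx => by
    have : m x = 0 := huniq x hx 0 x (by simp)
    simp [θ, this]
  obtain ⟨M, hM⟩ := (Set.finite_range fun i => |Ψ i g|).bddAbove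
  have hcont : ∀ i : Option ι, Continuous (i.elim θ Ψ : G →+ ℝ) := fun i => by
    cases i with
    | none => exact hθ
    | some i => exact hΨ i
  refine ⟨Option ι, inferInstance, fun i => i.elim θ Ψ, hcont, fun r => ?_⟩
  have hK : IsCompact (⋃ n ∈ Finset.Icc (-⌈r⌉) ⌈r⌉, (fun x => x + n • g) ''
      (((↑) : H → G) '' {h | ∀ i, |Φ i h| ≤ r + |r| * M})) :=
    Finset.isCompact_biUnion _ fun n _ => ((hc _).image continuous_subtype_val).image (by fun_prop)
  refine hK.of_isClosed_subset (isClosed_setOf_forall_abs_le hcont r) fun x hx => ?_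
  have h0 : |(m x : ℝ)| ≤ r := hx none
  have hr : |r| = r := abs_of_nonneg ((abs_nonneg _).trans h0)
  have hmem : m x ∈ Finset.Icc (-⌈r⌉) ⌈r⌉ := by
    have := abs_le.1 (h0.trans (Int.le_ceil r))
    rw [Finset.mem_Icc]
    exact ⟨by exact_mod_cast this.1, by exact_mod_cast this.2⟩
  refine Set.mem_biUnion (Finset.mem_coe.2 hmem) ⟨p x, ⟨⟨p x, hp x⟩, fun i => ?_, rfl⟩, (hpm x).symm⟩
  have h1 : |Ψ i x| ≤ r := hx (some i)
  have h2 : Φ i ⟨p x, hp x⟩ = Ψ i x - m x * Ψ i g := by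
    have h3 : p x = x - m x • g := eq_sub_of_add_eq (hpm x).symm
    rw [← hΨΦ]
    change Ψ i (p x) = _
    rw [h3, map_sub, map_zsmul, zsmul_eq_mul]
  rw [h2]
  refine (abs_sub _ _).trans (add_le_add h1 ?_)
  rw [abs_mul, hr]
  exact mul_le_mul h0 (hM ⟨i, rfl⟩) (abs_nonneg _) ((abs_nonneg _).trans h0)

/-- The subgroup generated by a compact neighbourhood of `0` has a proper homomorphism to some
`ℝⁿ`. -/
theorem hasProperRealCharacters_closure [LocallyCompactSpace G] [T2Space G] {B : Set G}
    (hB : IsCompact B) (hB0 : B ∈ 𝓝 (0 : G)) :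
    HasProperRealCharacters (AddSubgroup.closure B) := by
  have h := AddSubgroup.induction_sup_closure_compact (fun H => HasProperRealCharacters H)
    (fun H H' hH hH' hle hco hP => by
      obtain ⟨B, hB, h⟩ := AddSubgroup.cocompact_addSubgroupOf hle hH' hco
      have := hH'.isClosedEmbedding_subtypeVal.locallyCompactSpace
      exact (hP.addSubgroupOf hle).of_cocompact (AddSubgroup.isClosed_addSubgroupOf hH) hB h)
    (fun H g _ _ hV hg hP => by
      refine (hP.addSubgroupOf le_sup_left).of_cyclic (AddSubgroup.addSubgroupOf_mem_nhds hV)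
        (g := ⟨g, AddSubgroup.mem_sup_right (AddSubgroup.mem_zmultiples g)⟩) (fun x => ?_)
        fun n hn => hg n hn
      obtain ⟨a, ha, b, hb, hab⟩ := AddSubgroup.mem_sup.1 x.2
      obtain ⟨n, rfl⟩ := AddSubgroup.mem_zmultiples_iff.1 hb
      exact ⟨⟨a, AddSubgroup.mem_sup_left ha⟩, ha, n, Subtype.ext hab.symm⟩)
    (X := ⊥) (by simp)
    ⟨Empty, inferInstance, Empty.elim, fun i => i.elim, fun r => (Set.toFinite _).isCompact⟩ hB hB0
  rwa [bot_sup_eq] at h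

end ProperCharacters

/-! ### Sections over the real line and lifting of one-parameter subgroups -/

section OneParameterSubgroups

open Topology

variable {G : Type*} [AddCommGroup G] [TopologicalSpace G] [IsTopologicalAddGroup G]
  [LocallyCompactSpace G] [T2Space G] {π : G →+ ℝ}

/-- Let `π` be a proper homomorphism onto `ℝ` which is onto on no proper closed subgroup. Then `π`
is injective. -/
theorem AddMonoidHom.injective_of_minimal (hπ : Continuous π)
    (hproper : ∀ K : Set ℝ, IsCompact K → IsCompact (π ⁻¹' K)) (hsurj : Function.Surjective π)
    (hmin : ∀ H : AddSubgroup G, IsClosed (H : Set G) → (∀ t, ∃ h ∈ H, π h = t) → H = ⊤) :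
    Function.Injective π := by
  refine (injective_iff_map_eq_zero π).2 fun c hc => ?_
  by_contra hc0
  obtain ⟨χ, hχ, hχc⟩ := exists_continuous_addCharacter_ne_one hc0
  have hχ0 : χ (.ofAdd (0 : G)) = 1 := map_one χ
  have hχadd : ∀ a b : G, χ (.ofAdd (a + b)) = χ (.ofAdd a) * χ (.ofAdd b) := fun a b => by
    rw [ofAdd_add, map_mul]
  have hχneg : ∀ a : G, χ (.ofAdd (-a)) = (χ (.ofAdd a))⁻¹ := fun a => by
    rw [ofAdd_neg, map_inv]
  let F : G → ℝ × Circle := fun x => (π x, χ (.ofAdd x))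
  have hF : IsProperMap F := by
    refine isProperMap_iff_isCompact_preimage.2 ⟨hπ.prodMk hχ, fun K hK => ?_⟩
    exact (hproper _ (hK.image continuous_fst)).of_isClosed_subset
      (hK.isClosed.preimage (hπ.prodMk hχ)) fun x hx => ⟨_, hx, rfl⟩
  -- The image of `F`, which is closed by properness, unrolled along `Circle.exp` to a closed
  -- subgroup of the plane.
  let D : AddSubgroup (ℝ × ℝ) :=
    { carrier := {p | ∃ h, π h = p.1 ∧ χ (.ofAdd h) = Circle.exp p.2}
      add_mem' := by
        rintro p q ⟨h, h1, h2⟩ ⟨h', h1', h2'⟩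
        refine ⟨h + h', by simp [h1, h1'], ?_⟩
        rw [hχadd, h2, h2', Prod.snd_add, Circle.exp_add]
      zero_mem' := ⟨0, by simp, by simp⟩
      neg_mem' := by
        rintro p ⟨h, h1, h2⟩
        refine ⟨-h, by simp [h1], ?_⟩
        rw [hχneg, h2, Prod.snd_neg, Circle.exp_neg] }
  have hD : IsClosed (D : Set (ℝ × ℝ)) := by
    have : (D : Set (ℝ × ℝ)) = (fun p : ℝ × ℝ => (p.1, Circle.exp p.2)) ⁻¹' Set.range F := by
      ext p
      exact exists_congr fun h =>
        (Prod.ext_iff (x := F h) (y := (p.1, Circle.exp p.2))).symm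
    rw [this]
    exact hF.isClosedMap.isClosed_range.preimage (by fun_prop)
  obtain ⟨v, hv1, hv⟩ := AddSubgroup.exists_line_of_surjective hD (LinearMap.fst ℝ ℝ ℝ) fun t => by
    obtain ⟨h, rfl⟩ := hsurj t
    obtain ⟨s, hs⟩ := Circle.exp_surjective (χ (.ofAdd h))
    exact ⟨(π h, s), ⟨h, rfl, hs.symm⟩, rfl⟩
  replace hv1 : v.1 = 1 := hv1
  -- The line in `D` has slope `v.2`, so `H` still surjects and by minimality is everything. Then
  -- `χ` factors through `π` and cannot detect `c`.
  let H : AddSubgroup G :=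
    { carrier := {h | χ (.ofAdd h) = Circle.exp (π h * v.2)}
      add_mem' := fun {a b} ha hb => by
        change χ (.ofAdd (a + b)) = _
        rw [hχadd, ha, hb, map_add, add_mul, Circle.exp_add]
      zero_mem' := by simp
      neg_mem' := fun {a} ha => by
        change χ (.ofAdd (-a)) = _
        rw [hχneg, ha, map_neg, neg_mul, Circle.exp_neg] }
  have hH : H = ⊤ := hmin H (isClosed_eq hχ (by fun_prop)) fun t => by
    obtain ⟨h, h1, h2⟩ := hv t
    have h3 : π h = t := by simpa [hv1] using h1
    refine ⟨h, ?_, h3⟩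
    change χ (.ofAdd h) = Circle.exp (π h * v.2)
    rw [h2, h3]
    rfl
  have hcH : c ∈ H := by rw [hH]; trivial
  have : χ (.ofAdd c) = Circle.exp (π c * v.2) := hcH
  exact hχc (by simpa [hc] using this)

/-- A proper homomorphism onto `ℝ` is onto on a minimal closed subgroup. -/
theorem AddMonoidHom.exists_minimal_closed_subgroup (hπ : Continuous π)
    (hproper : ∀ K : Set ℝ, IsCompact K → IsCompact (π ⁻¹' K)) (hsurj : Function.Surjective π) :
    ∃ M : AddSubgroup G, IsClosed (M : Set G) ∧ (∀ t, ∃ h ∈ M, π h = t) ∧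
      ∀ H : AddSubgroup G, IsClosed (H : Set G) → (∀ t, ∃ h ∈ H, π h = t) → H ≤ M → H = M := by
  let S : Set (AddSubgroup G)ᵒᵈ := {H | IsClosed ((OrderDual.ofDual H : AddSubgroup G) : Set G) ∧
    ∀ t, ∃ h ∈ OrderDual.ofDual H, π h = t}
  obtain ⟨M, -, hM⟩ := zorn_le_nonempty₀ S (fun c hcS hchain y hy => by
    refine ⟨OrderDual.toDual (sInf (OrderDual.ofDual ⁻¹' c)), ⟨?_, fun t => ?_⟩, fun z hz =>
      sInf_le (α := AddSubgroup G) hz⟩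
    · rw [OrderDual.ofDual_toDual, AddSubgroup.coe_sInf]
      exact isClosed_biInter fun H hH => (hcS hH).1
    · have : Nonempty c := ⟨⟨y, hy⟩⟩
      -- Fibres are compact by properness, so the intersection of a chain still meets each of them.
      have hfib : IsClosed (π ⁻¹' {t}) := isClosed_singleton.preimage hπ
      obtain ⟨x, hx⟩ := IsCompact.nonempty_iInter_of_directed_nonempty_isCompact_isClosed
        (fun H : c => ((OrderDual.ofDual H.1 : AddSubgroup G) : Set G) ∩ π ⁻¹' {t})
        (fun H H' => by
          rcases hchain.total H.2 H'.2 with h | h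
          · exact ⟨H', Set.inter_subset_inter_left _ h, le_rfl⟩
          · exact ⟨H, le_rfl, Set.inter_subset_inter_left _ h⟩)
        (fun H => by
          obtain ⟨h, hh, ht⟩ := (hcS H.2).2 t
          exact ⟨h, hh, ht⟩)
        (fun H => (hproper _ isCompact_singleton).inter_left (hcS H.2).1)
        (fun H => (hcS H.2).1.inter hfib)
      rw [Set.mem_iInter] at hx
      exact ⟨x, AddSubgroup.mem_sInf.2 fun H hH => (hx ⟨H, hH⟩).1, (hx ⟨y, hy⟩).2⟩)
    (OrderDual.toDual ⊤) ⟨by simp, fun t => by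
      obtain ⟨x, rfl⟩ := hsurj t
      exact ⟨x, by simp, rfl⟩⟩
  exact ⟨M, hM.prop.1, hM.prop.2, fun H hH hHt hle =>
    le_antisymm hle (hM.le_of_ge (y := OrderDual.toDual H) ⟨hH, hHt⟩ hle)⟩

/-- On a minimal closed subgroup that surjects, `π` is a proper continuous bijection, hence a
homeomorphism; invert it. -/
theorem AddMonoidHom.exists_section_of_proper (hπ : Continuous π)
    (hproper : ∀ K : Set ℝ, IsCompact K → IsCompact (π ⁻¹' K)) (hsurj : Function.Surjective π) :
    ∃ s : ℝ →+ G, Continuous s ∧ ∀ t, π (s t) = t := by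
  obtain ⟨M, hM, hMt, hmin⟩ := exists_minimal_closed_subgroup hπ hproper hsurj
  have hemb := hM.isClosedEmbedding_subtypeVal
  have := hemb.locallyCompactSpace
  let ρ : M →+ ℝ := π.comp M.subtype
  have hρ : Continuous ρ := hπ.comp continuous_subtype_val
  have hρproper : ∀ K : Set ℝ, IsCompact K → IsCompact (ρ ⁻¹' K) := fun K hK =>
    hemb.isCompact_preimage (hproper K hK)
  have hρsurj : Function.Surjective ρ := fun t => by
    obtain ⟨h, hh, rfl⟩ := hMt t
    exact ⟨⟨h, hh⟩, rfl⟩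
  have hinj : Function.Injective ρ := injective_of_minimal hρ hρproper hρsurj fun H hH hHt => by
    have h1 := hmin (H.map M.subtype) (hemb.isClosedMap _ hH) (fun t => by
      obtain ⟨h, hh, rfl⟩ := hHt t
      exact ⟨h, ⟨h, hh, rfl⟩, rfl⟩) (by
        rintro _ ⟨h, -, rfl⟩
        exact h.2)
    refine (AddSubgroup.eq_top_iff' H).2 fun x => ?_
    have h2 : (x : G) ∈ H.map M.subtype := by rw [h1]; exact x.2
    obtain ⟨y, hy, hyx⟩ := h2
    rwa [← Subtype.ext hyx]
  let e : M ≃+ ℝ := AddEquiv.ofBijective ρ ⟨hinj, hρsurj⟩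
  have hcl : IsClosedMap e :=
    (isProperMap_iff_isCompact_preimage.2 ⟨hρ, fun K hK => hρproper K hK⟩).isClosedMap
  refine ⟨M.subtype.comp e.symm.toAddMonoidHom, continuous_subtype_val.comp
    (e.toEquiv.toHomeomorphOfContinuousClosed hρ hcl).symm.continuous, fun t => e.apply_symm_apply t⟩

/-- With `π` adjoined as a coordinate, the proper map has closed image, which contains a line
parametrised by `π`. On the preimage of this line `π` alone is proper. -/
theorem HasProperRealCharacters.exists_section (h : HasProperRealCharacters G) (hπ : Continuous π)
    (hsurj : Function.Surjective π) : ∃ s : ℝ →+ G, Continuous s ∧ ∀ t, π (s t) = t := by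
  obtain ⟨ι, _, Φ, hΦ, hc⟩ := h
  let F : G →+ ℝ × (ι → ℝ) := π.prod (AddMonoidHom.mk' (fun x i => Φ i x) fun x y => by
    ext i
    simp)
  have hFc : Continuous F := hπ.prodMk (continuous_pi hΦ)
  have hF : IsProperMap F := by
    refine isProperMap_iff_isCompact_preimage.2 ⟨hFc, fun K hK => ?_⟩
    obtain ⟨r, hr⟩ := hK.isBounded.exists_norm_le
    refine (hc r).of_isClosed_subset (hK.isClosed.preimage hFc) fun x hx i => ?_
    exact ((norm_le_pi_norm (F x).2 i).trans (norm_snd_le _)).trans (hr _ hx)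
  obtain ⟨v, hv1, hv⟩ := AddSubgroup.exists_line_of_surjective (D := F.range)
    (by simpa using hF.isClosedMap.isClosed_range) (LinearMap.fst ℝ ℝ (ι → ℝ)) fun t => by
      obtain ⟨h, rfl⟩ := hsurj t
      exact ⟨F h, ⟨h, rfl⟩, rfl⟩
  replace hv1 : v.1 = 1 := hv1
  let H : AddSubgroup G :=
    { carrier := {h | F h = π h • v}
      add_mem' := fun {a b} ha hb => by
        change F (a + b) = _
        rw [map_add, ha, hb, map_add, add_smul]
      zero_mem' := by simp
      neg_mem' := fun {a} ha => by
        change F (-a) = _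
        rw [map_neg, ha, map_neg, neg_smul] }
  have hH : IsClosed (H : Set G) := isClosed_eq hFc (by fun_prop)
  have hemb := hH.isClosedEmbedding_subtypeVal
  have := hemb.locallyCompactSpace
  have hline : Continuous fun t : ℝ => t • v := by fun_prop
  obtain ⟨s, hs, hπs⟩ := AddMonoidHom.exists_section_of_proper (π := π.comp H.subtype)
    (hπ.comp continuous_subtype_val)
    (fun K hK => by
      refine (hemb.isCompact_preimage (hF.isCompact_preimage (hK.image hline))).of_isClosed_subset
        (hK.isClosed.preimage (hπ.comp continuous_subtype_val)) fun x hx => ?_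
      exact ⟨π x, hx, x.2.symm⟩)
    (fun t => by
      obtain ⟨h, hh⟩ := hv t
      have h3 : (F h).1 = t := by simpa [hv1] using congrArg Prod.fst hh
      replace h3 : π h = t := h3
      refine ⟨⟨h, ?_⟩, h3⟩
      change F h = π h • v
      rw [hh, h3])
  exact ⟨H.subtype.comp s, continuous_subtype_val.comp hs, hπs⟩

/-- A continuous homomorphism from a locally compact abelian group to `ℝ` that is onto on every open
subgroup has a continuous section. -/
theorem AddMonoidHom.exists_continuous_section (hπ : Continuous π)
    (hsurj : ∀ O : AddSubgroup G, IsOpen (O : Set G) → ∀ t, ∃ x ∈ O, π x = t) :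
    ∃ s : ℝ →+ G, Continuous s ∧ ∀ t, π (s t) = t := by
  obtain ⟨B, hB, hB0⟩ := exists_compact_mem_nhds (0 : G)
  have hO : IsOpen (AddSubgroup.closure B : Set G) := AddSubgroup.isOpen_of_mem_nhds _ (g := 0)
    (Filter.mem_of_superset hB0 AddSubgroup.subset_closure)
  have := ((AddSubgroup.closure B).isClosed_of_isOpen hO).isClosedEmbedding_subtypeVal.locallyCompactSpace
  obtain ⟨s, hs, hπs⟩ := (hasProperRealCharacters_closure hB hB0).exists_section
    (π := π.comp (AddSubgroup.closure B).subtype) (hπ.comp continuous_subtype_val) fun t => by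
      obtain ⟨x, hx, rfl⟩ := hsurj _ hO t
      exact ⟨⟨x, hx⟩, rfl⟩
  exact ⟨(AddSubgroup.closure B).subtype.comp s, continuous_subtype_val.comp hs, hπs⟩

/-- Continuous one-parameter subgroups lift along open surjective homomorphisms of locally compact
abelian groups. -/
theorem exists_lift_real {Y Z : Type*} [AddCommGroup Y] [TopologicalSpace Y]
    [IsTopologicalAddGroup Y] [LocallyCompactSpace Y] [T2Space Y] [AddCommGroup Z]
    [TopologicalSpace Z] [T2Space Z] {p : Y →+ Z} (hp : Continuous p) (hpo : IsOpenMap p)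
    {γ : ℝ →+ Z} (hγ : Continuous γ) : ∃ s : ℝ →+ Y, Continuous s ∧ ∀ t, p (s t) = γ t := by
  -- The fibre product of `p` and `γ`: a section of its projection to `ℝ` is a lift of `γ`.
  let E : AddSubgroup (Y × ℝ) :=
    (p.comp (AddMonoidHom.fst Y ℝ)).eqLocus (γ.comp (AddMonoidHom.snd Y ℝ))
  have hE : IsClosed (E : Set (Y × ℝ)) :=
    isClosed_eq (hp.comp continuous_fst) (hγ.comp continuous_snd)
  have := hE.isClosedEmbedding_subtypeVal.locallyCompactSpace
  let π : E →+ ℝ := (AddMonoidHom.snd Y ℝ).comp E.subtype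
  have hπ : Continuous π := continuous_snd.comp continuous_subtype_val
  obtain ⟨s, hs, hπs⟩ := AddMonoidHom.exists_continuous_section hπ fun O hO => by
    have h0 : (O : Set E) ∈ 𝓝 (0 : E) := hO.mem_nhds O.zero_mem
    rw [mem_nhds_subtype] at h0
    obtain ⟨N, hN, hNO⟩ := h0
    obtain ⟨U, hU, I, hI, hUI⟩ := mem_nhds_prod_iff.1 hN
    -- Openness of `p` makes the image of `O` in `ℝ` a neighbourhood of `0`; an open subgroup of the
    -- connected group `ℝ` is everything.
    have hJ : I ∩ γ ⁻¹' (p '' U) ∈ 𝓝 (0 : ℝ) := by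
      refine Filter.inter_mem hI (hγ.continuousAt.preimage_mem_nhds ?_)
      have := hpo.image_mem_nhds hU
      rw [map_zero]
      simpa using this
    have hmap : (O.map π : Set ℝ) ∈ 𝓝 (0 : ℝ) := by
      refine Filter.mem_of_superset hJ ?_
      rintro t ⟨htI, y, hy, hyt⟩
      exact ⟨⟨(y, t), hyt⟩, hNO (hUI ⟨hy, htI⟩), rfl⟩
    have hopen : IsOpen (O.map π : Set ℝ) := (O.map π).isOpen_of_mem_nhds hmap
    have htop : (O.map π : Set ℝ) = Set.univ :=
      IsClopen.eq_univ ⟨(O.map π).isClosed_of_isOpen hopen, hopen⟩ ⟨0, (O.map π).zero_mem⟩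
    intro t
    have ht : t ∈ (O.map π : Set ℝ) := by rw [htop]; trivial
    exact ht
  refine ⟨(AddMonoidHom.fst Y ℝ).comp (E.subtype.comp s),
    continuous_fst.comp (continuous_subtype_val.comp hs), fun t => ?_⟩
  have h1 : p (s t).1.1 = γ (s t).1.2 := (s t).2
  exact h1.trans (congrArg γ (hπs t))

end OneParameterSubgroups

/-! ### Topology of admissible monics and epics -/

namespace LCAMod

open Topology

variable {R : Type v} [Ring R]

/-- A closed submodule as a locally compact module. -/
def ofClosedSubmodule (Y : LCAMod.{u} R) (N : Submodule R Y) (hN : IsClosed (N : Set Y)) :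
    LCAMod.{u} R :=
  have : LocallyCompactSpace N := hN.isClosedEmbedding_subtypeVal.locallyCompactSpace
  have : ContinuousConstSMul R N :=
    ⟨fun c => Continuous.subtype_mk (continuous_subtype_val.const_smul c) _⟩
  { carrier := N }

/-- The quotient by a closed submodule as a locally compact module. -/
def quotient (Y : LCAMod.{u} R) (N : Submodule R Y) (hN : IsClosed (N : Set Y)) :
    LCAMod.{u} R :=
  have : T2Space (Y ⧸ N) := by
    have : IsClosed (N : Set Y) := hN
    infer_instance
  have : LocallyCompactSpace (Y ⧸ N) :=
    N.isOpenQuotientMap_mkQ.locallyCompactSpace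
  have : ContinuousConstSMul R (Y ⧸ N) :=
    ⟨fun c => N.isOpenQuotientMap_mkQ.isQuotientMap.continuous_iff.2
      (N.isOpenQuotientMap_mkQ.continuous.comp (continuous_const_smul c))⟩
  { carrier := Y ⧸ N }

/-- The closed submodule `ker p` is itself a kernel of `p`, and the universal property identifies
`X` with it homeomorphically. -/
theorem isClosedEmbedding_of_isAdmissibleMonic {X Y : LCAMod.{u} R} (i : X →L[R] Y)
    (hi : IsAdmissibleMonic (show X ⟶ Y from i)) : IsClosedEmbedding i := by
  obtain ⟨Z, p, w, ⟨hl⟩, -⟩ := hi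
  let p' : Y →L[R] Z := p
  have w' : ∀ x, p' (i x) = 0 := fun x => DFunLike.congr_fun (show p'.comp i = 0 from w) x
  let N : Submodule R Y := LinearMap.ker (p' : Y →ₗ[R] Z)
  have hN : IsClosed (N : Set Y) := isClosed_eq p'.continuous continuous_const
  let K := Y.ofClosedSubmodule N hN
  let k : K →L[R] Y := N.subtypeL
  let d : X →L[R] K := i.codRestrict N w'
  obtain ⟨l, hlk⟩ := KernelFork.IsLimit.lift' hl (show K ⟶ Y from k)
    (show p'.comp k = 0 from ContinuousLinearMap.ext fun x => x.2)
  let l' : K →L[R] X := l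
  have hlk' : ∀ x, i (l' x) = k x := fun x => DFunLike.congr_fun (show i.comp l' = k from hlk) x
  have hdl : ∀ x, l' (d x) = x := fun x => by
    have h : (show X ⟶ X from l'.comp d) = 𝟙 X := Fork.IsLimit.hom_ext hl <|
      show i.comp (l'.comp d) = i.comp (ContinuousLinearMap.id R X) from
        ContinuousLinearMap.ext fun x => hlk' (d x)
    exact DFunLike.congr_fun (show l'.comp d = ContinuousLinearMap.id R X from h) x
  let e : X ≃ₜ K :=
    { toFun := d
      invFun := l'
      left_inv := hdl
      right_inv := fun x => Subtype.ext (hlk' x)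
      continuous_toFun := d.continuous
      continuous_invFun := l'.continuous }
  have hk : IsClosedEmbedding k := hN.isClosedEmbedding_subtypeVal
  exact hk.comp e.isClosedEmbedding

/-- The cokernel of `i` is the quotient by the closure of its range, the closure being needed for a
Hausdorff quotient; quotient maps of groups are open. -/
theorem isOpenMap_of_isAdmissibleEpic {Y Z : LCAMod.{u} R} (p : Y →L[R] Z)
    (hp : IsAdmissibleEpic (show Y ⟶ Z from p)) : IsOpenMap p := by
  obtain ⟨X, i, w, -, ⟨hc⟩⟩ := hp
  let i' : X →L[R] Y := i
  have w' : ∀ x, p (i' x) = 0 := fun x => DFunLike.congr_fun (show p.comp i' = 0 from w) x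
  let N : Submodule R Y := (LinearMap.range (i' : X →ₗ[R] Y)).topologicalClosure
  have hN : IsClosed (N : Set Y) := Submodule.isClosed_topologicalClosure _
  let Q := Y.quotient N hN
  let q : Y →L[R] Q := N.mkQL
  have hq : IsOpenQuotientMap q := N.isOpenQuotientMap_mkQ
  obtain ⟨d, hd⟩ := CokernelCofork.IsColimit.desc' hc (show Y ⟶ Q from q)
    (show q.comp i' = 0 from ContinuousLinearMap.ext fun x =>
      (Submodule.Quotient.mk_eq_zero N).2 (Submodule.le_topologicalClosure _ ⟨x, rfl⟩))
  let d' : Z →L[R] Q := d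
  have hd' : ∀ y, d' (p y) = q y := fun y => DFunLike.congr_fun (show d'.comp p = q from hd) y
  have hNp : N ≤ LinearMap.ker (p : Y →ₗ[R] Z) :=
    Submodule.topologicalClosure_minimal _ (by rintro _ ⟨x, rfl⟩; exact w' x)
      (isClosed_eq p.continuous continuous_const)
  let r : Q →L[R] Z :=
    { N.liftQ (p : Y →ₗ[R] Z) hNp with
      cont := hq.isQuotientMap.continuous_iff.2 p.continuous }
  have hrq : ∀ y, r (q y) = p y := fun y => rfl
  have hrd : ∀ z, r (d' z) = z := fun z => by
    have h : (show Z ⟶ Z from r.comp d') = 𝟙 Z := Cofork.IsColimit.hom_ext hc <|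
      show (r.comp d').comp p = (ContinuousLinearMap.id R Z).comp p from
        ContinuousLinearMap.ext fun y => (congrArg r (hd' y)).trans (hrq y)
    exact DFunLike.congr_fun (show r.comp d' = ContinuousLinearMap.id R Z from h) z
  have hdr : ∀ x, d' (r x) = x := fun x => by
    obtain ⟨y, rfl⟩ := hq.surjective x
    exact hd' y
  let e : Q ≃ₜ Z :=
    { toFun := r
      invFun := d'
      left_inv := hdr
      right_inv := hrd
      continuous_toFun := r.continuous
      continuous_invFun := d'.continuous }
  exact e.isOpenMap.comp hq.isOpenMap

end LCAMod

/-! ### Trace forms and averaging over an order -/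

section Averaging

/-- The trace of left multiplication, for a possibly noncommutative algebra. -/
noncomputable def regularTrace (K A : Type*) [Field K] [Ring A] [Algebra K A] : A →ₗ[K] K :=
  (LinearMap.trace K A).comp (Algebra.lmul K A).toLinearMap

theorem regularTrace_apply {K A : Type*} [Field K] [Ring A] [Algebra K A] (a : A) :
    regularTrace K A a = LinearMap.trace K A (Algebra.lmul K A a) := rfl

theorem regularTrace_mul_comm {K A : Type*} [Field K] [Ring A] [Algebra K A] (a b : A) :
    regularTrace K A (a * b) = regularTrace K A (b * a) := by
  rw [regularTrace_apply, regularTrace_apply, map_mul (Algebra.lmul K A),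
    map_mul (Algebra.lmul K A), LinearMap.trace_mul_comm]

/-- The trace form of a finite-dimensional semisimple algebra in characteristic zero is
nondegenerate. -/
theorem eq_zero_of_trace_mul_eq_zero {K A : Type*} [Field K] [CharZero K] [Ring A] [Algebra K A]
    [Module.Finite K A] [IsSemisimpleRing A] {a : A}
    (ha : ∀ b, regularTrace K A (a * b) = 0) : a = 0 := by
  let I : Ideal A :=
    { carrier := {x | ∀ b, regularTrace K A (x * b) = 0}
      add_mem' := fun {x y} hx hy b => by rw [add_mul, map_add, hx, hy, add_zero]
      zero_mem' := fun b => by simp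
      smul_mem' := fun c x hx b => by
        rw [smul_eq_mul, mul_assoc, regularTrace_mul_comm, mul_assoc]
        exact hx _ }
  -- The radical of the trace form is generated by an idempotent. Left multiplication by it is a
  -- projection of trace zero, hence zero in characteristic zero.
  obtain ⟨e, he, hI⟩ := IsSemisimpleRing.ideal_eq_span_idempotent I
  have heI : e ∈ I := hI ▸ Ideal.mem_span_singleton_self e
  have h1 : LinearMap.trace K A (Algebra.lmul K A e) = 0 := by
    simpa [regularTrace_apply] using heI 1
  have h2 : IsIdempotentElem (Algebra.lmul K A e) := he.map _
  have h3 := LinearMap.IsIdempotentElem.eq_zero_of_trace_eq_zero h2 h1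
  have he0 : e = 0 := by simpa using LinearMap.congr_fun h3 1
  have haI : a ∈ I := ha
  simpa [hI, he0] using haI

/-- The dual basis with respect to the trace form transforms contragrediently, and the Casimir
element of the trace form is `1`. -/
theorem exists_trace_dual_basis {K A ι : Type*} [Field K] [CharZero K] [Ring A] [Algebra K A]
    [IsSemisimpleRing A] [Fintype ι] (b : Module.Basis ι K A) :
    ∃ d : ι → A, (∀ a j, d j * a = ∑ i, b.repr (a * b i) j • d i) ∧ ∑ i, b i * d i = 1 := by
  classical
  have := Module.Finite.of_basis b
  let B : LinearMap.BilinForm K A := (LinearMap.mul K A).compr₂ (regularTrace K A)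
  have hBapp : ∀ x y, B x y = regularTrace K A (x * y) := fun x y => rfl
  have hB0 : ∀ x, (∀ y, B x y = 0) → x = 0 := fun x hx => eq_zero_of_trace_mul_eq_zero hx
  have hBsymm : ∀ x y, B x y = B y x := fun x y => regularTrace_mul_comm x y
  have hB : B.Nondegenerate := ⟨hB0, fun y hy => hB0 y fun x => by rw [hBsymm]; exact hy x⟩
  let d := B.dualBasis hB b
  have hd : ∀ i x, B (d i) x = b.repr x i := fun i x => by
    conv_lhs => rw [← b.sum_repr x]
    rw [map_sum]
    simp [d, LinearMap.BilinForm.apply_dualBasis_left]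
  have hext : ∀ x y, (∀ i, B x (b i) = B y (b i)) → x = y := fun x y h => by
    have : B (x - y) = 0 := b.ext fun i => by simp [h i]
    exact sub_eq_zero.1 (hB0 _ fun z => by rw [this]; rfl)
  refine ⟨d, fun a j => hext _ _ fun k => ?_, ?_⟩
  · have h1 : B (d j * a) (b k) = B (d j) (a * b k) := by rw [hBapp, hBapp, mul_assoc]
    rw [h1, hd, map_sum, LinearMap.sum_apply]
    simp [hd, Finsupp.single_apply]
  -- Paired with `b k`, the Casimir element gives the sum of the diagonal coefficients of left
  -- multiplication by `b k`. This is its regular trace, which is also the pairing of `1` with `b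
  -- k`.
  · refine hext _ _ fun k => ?_
    rw [hBsymm, hBsymm 1, hBapp, hBapp, mul_one, Finset.mul_sum, map_sum,
      regularTrace_apply,
      LinearMap.trace_eq_matrix_trace K b, Matrix.trace]
    refine Finset.sum_congr rfl fun i _ => ?_
    rw [← mul_assoc, regularTrace_mul_comm, ← hBapp, hd, Matrix.diag_apply,
      LinearMap.toMatrix_apply]
    rfl

/-- Finite families `e`, `f` in a ring that can be used to average additive maps between modules. -/
def HasAveragingFamily (R : Type*) [Ring R] : Prop :=
  ∃ (ι : Type) (_ : Fintype ι) (e f : ι → R) (N : ℕ), N ≠ 0 ∧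
    (∀ a : R, ∃ m : ι → ι → ℤ, (∀ i, a * e i = ∑ j, m i j • e j) ∧
      ∀ j, f j * a = ∑ i, m i j • f i) ∧ ∑ i, e i * f i = N

/-- The conditions are symmetric under reversing products and exchanging `e` with `f`; only the
matrix is transposed. -/
theorem HasAveragingFamily.op {R : Type*} [Ring R] (h : HasAveragingFamily R) :
    HasAveragingFamily Rᵐᵒᵖ := by
  obtain ⟨ι, hι, e, f, N, hN, hm, hsum⟩ := h
  refine ⟨ι, hι, fun i => .op (f i), fun i => .op (e i), N, hN, fun a => ?_, ?_⟩
  · obtain ⟨m, h1, h2⟩ := hm a.unop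
    refine ⟨fun i j => m j i, fun i => MulOpposite.unop_injective ?_,
      fun j => MulOpposite.unop_injective ?_⟩
    · simpa [-zsmul_eq_mul] using h2 i
    · simpa [-zsmul_eq_mul] using h1 j
  · refine MulOpposite.unop_injective ?_
    simpa using hsum

theorem IsOrder.exists_nsmul_mem {A : Type v} [Ring A] [Algebra ℚ A] {𝔄 : Subring A}
    (h𝔄 : IsOrder 𝔄) (x : A) : ∃ n : ℕ, n ≠ 0 ∧ n • x ∈ 𝔄 := by
  have hx : x ∈ Submodule.span ℚ (𝔄 : Set A) := by rw [h𝔄.span_eq_top]; trivial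
  induction hx using Submodule.span_induction with
  | mem x hx => exact ⟨1, one_ne_zero, by simpa using hx⟩
  | zero => exact ⟨1, one_ne_zero, by simp⟩
  | add x y _ _ ihx ihy =>
    obtain ⟨n, hn, hnx⟩ := ihx
    obtain ⟨m, hm, hmy⟩ := ihy
    refine ⟨n * m, mul_ne_zero hn hm, ?_⟩
    rw [smul_add]
    refine 𝔄.add_mem ?_ ?_
    · rw [mul_comm, mul_smul]
      exact 𝔄.nsmul_mem hnx m
    · rw [mul_smul]
      exact 𝔄.nsmul_mem hmy n
  | smul q x _ ih =>
    obtain ⟨n, hn, hnx⟩ := ih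
    refine ⟨q.den * n, mul_ne_zero q.den_ne_zero hn, ?_⟩
    have : (q.den * n) • q • x = q.num • n • x := by
      simp only [← Nat.cast_smul_eq_nsmul ℚ, ← Int.cast_smul_eq_zsmul ℚ, smul_smul]
      congr 1
      push_cast
      rw [← Rat.den_mul_eq_num q]
      ring
    rw [this]
    exact 𝔄.zsmul_mem hnx _

/-- A `ℤ`-basis of the order is a `ℚ`-basis of `A`, so its multiplication matrices are integral. `N`
clears the denominators of the trace-dual basis and becomes the value of the Casimir sum. -/
theorem IsOrder.hasAveragingFamily {A : Type v} [Ring A] [Algebra ℚ A] [IsSemisimpleRing A]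
    {𝔄 : Subring A} (h𝔄 : IsOrder 𝔄) : HasAveragingFamily 𝔄 := by
  classical
  have := h𝔄.finite
  have : IsAddTorsionFree A := IsAddTorsionFree.of_module_rat A
  have : IsAddTorsionFree 𝔄 :=
    Function.Injective.isAddTorsionFree (Subring.subtype 𝔄).toAddMonoidHom Subtype.val_injective
  let β := Module.finBasis ℤ 𝔄
  have hli : LinearIndependent ℚ fun i => (β i : A) := by
    rw [← LinearIndependent.iff_fractionRing ℤ ℚ]
    exact β.linearIndependent.map' (Subring.subtype 𝔄).toAddMonoidHom.toIntLinearMap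
      (LinearMap.ker_eq_bot.2 Subtype.val_injective)
  have hrepr : ∀ x : 𝔄, (x : A) = ∑ i, β.repr x i • (β i : A) := fun x => by
    conv_lhs => rw [← β.sum_repr x]
    simp
  have hspan : ⊤ ≤ Submodule.span ℚ (Set.range fun i => (β i : A)) := by
    rw [← h𝔄.span_eq_top, Submodule.span_le]
    intro x hx
    have h1 := hrepr ⟨x, hx⟩
    rw [SetLike.mem_coe, show x = _ from h1]
    refine Submodule.sum_mem _ fun i _ => ?_
    rw [← Int.cast_smul_eq_zsmul ℚ]
    exact Submodule.smul_mem _ _ (Submodule.subset_span ⟨i, rfl⟩)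
  let b := Module.Basis.mk hli hspan
  have hb : ∀ i, b i = β i := fun i => by simp [b]
  have hbr : ∀ (x : 𝔄) j, b.repr (x : A) j = β.repr x j := fun x j => by
    conv_lhs => rw [hrepr x]
    simp only [← hb, ← Int.cast_smul_eq_zsmul ℚ, b.repr_sum_self]
  obtain ⟨d, hd, hsum⟩ := exists_trace_dual_basis b
  choose n hn hnd using fun i => h𝔄.exists_nsmul_mem (d i)
  let N := ∏ i, n i
  have hN : N ≠ 0 := Finset.prod_ne_zero_iff.2 fun i _ => hn i
  have hNd : ∀ i, N • d i ∈ 𝔄 := fun i => by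
    obtain ⟨c, hc⟩ := Finset.dvd_prod_of_mem n (Finset.mem_univ i)
    change (∏ i, n i) • d i ∈ 𝔄
    rw [hc, mul_comm, mul_smul]
    exact 𝔄.nsmul_mem (hnd i) c
  refine ⟨_, inferInstance, β, fun i => ⟨N • d i, hNd i⟩, N, hN, fun a =>
    ⟨fun i j => β.repr (a * β i) j, fun i => (β.sum_repr _).symm, fun j => Subtype.ext ?_⟩,
    Subtype.ext ?_⟩
  · have h1 := hd a j
    simp only [hb, ← Subring.coe_mul, hbr, Int.cast_smul_eq_zsmul] at h1
    simp only [Subring.coe_mul, smul_mul_assoc, h1, Finset.smul_sum]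
    simp [smul_comm N, -nsmul_eq_mul, -zsmul_eq_mul]
  · simp only [hb] at hsum
    simp [← Finset.smul_sum, hsum, -nsmul_eq_mul]

/-- The same matrix `m` appears on both sides of `g`. Its entries must be integers because `g` is
only additive. -/
theorem smul_averaged_eq {R M M' ι : Type*} [Ring R] [AddCommGroup M] [Module R M]
    [AddCommGroup M'] [Module R M'] [Fintype ι] {e f : ι → R} {a : R} {m : ι → ι → ℤ}
    (he : ∀ i, a * e i = ∑ j, m i j • e j) (hf : ∀ j, f j * a = ∑ i, m i j • f i) (g : M →+ M')
    (x : M) : a • ∑ i, e i • g (f i • x) = ∑ i, e i • g (f i • a • x) := by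
  simp only [Finset.smul_sum, smul_smul, he, hf, Finset.sum_smul, map_sum]
  rw [Finset.sum_comm]
  refine Finset.sum_congr rfl fun j _ => Finset.sum_congr rfl fun i _ => ?_
  rw [smul_assoc, smul_assoc, map_zsmul, smul_comm]

end Averaging

/-! ### Extension and lifting for vector groups, by coordinates -/

section VectorGroups

open Topology

/-- Continuous homomorphisms to `ℝⁿ` extend along closed embeddings of locally compact abelian
groups. -/
theorem exists_extension_of_isClosedEmbedding {X Y V : Type*} [AddCommGroup X] [TopologicalSpace X]
    [AddCommGroup Y] [TopologicalSpace Y] [IsTopologicalAddGroup Y] [LocallyCompactSpace Y]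
    [AddCommGroup V] [TopologicalSpace V] {n : ℕ} (ε : V ≃ₜ+ (Fin n → ℝ)) {i : X →+ Y}
    (hi : IsClosedEmbedding i) {f : X →+ V} (hf : Continuous f) :
    ∃ g : Y →+ V, Continuous g ∧ ∀ x, g (i x) = f x := by
  let e : X ≃+ i.range := AddMonoidHom.ofInjective hi.injective
  have he : Continuous e.symm := by
    have h : ∀ y, hi.isEmbedding.toHomeomorph.symm y = e.symm y := fun y => by
      obtain ⟨x, rfl⟩ := e.surjective y
      rw [AddEquiv.symm_apply_apply]
      exact hi.isEmbedding.toHomeomorph.symm_apply_apply x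
    exact hi.isEmbedding.toHomeomorph.symm.continuous.congr h
  let φ : Fin n → i.range →+ ℝ := fun j =>
    ((Pi.evalAddMonoidHom (fun _ => ℝ) j).comp ε.toAddEquiv.toAddMonoidHom).comp
      (f.comp e.symm.toAddMonoidHom)
  have hφ : ∀ j, Continuous (φ j) := fun j =>
    (continuous_apply j).comp (ε.continuous.comp (hf.comp he))
  have hcl : IsClosed (i.range : Set Y) := by simpa using hi.isClosed_range
  choose Φ hΦ hΦφ using fun j => AddSubgroup.exists_extension_real hcl (hφ j)
  refine ⟨ε.symm.toAddEquiv.toAddMonoidHom.comp (AddMonoidHom.pi Φ),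
    ε.symm.continuous.comp (continuous_pi hΦ), fun x => ?_⟩
  change ε.symm (fun j => Φ j (i x)) = f x
  rw [← ε.symm_apply_apply (f x)]
  refine congrArg _ (funext fun j => (hΦφ j (e x)).trans ?_)
  change ε (f (e.symm (e x))) j = _
  rw [AddEquiv.symm_apply_apply]

/-- Continuous homomorphisms from `ℝⁿ` lift along open surjections of locally compact abelian
groups. -/
theorem exists_lift_of_isOpenMap {Y Z V : Type*} [AddCommGroup Y] [TopologicalSpace Y]
    [IsTopologicalAddGroup Y] [LocallyCompactSpace Y] [T2Space Y] [AddCommGroup Z]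
    [TopologicalSpace Z] [T2Space Z] [AddCommGroup V] [TopologicalSpace V] {n : ℕ}
    (ε : V ≃ₜ+ (Fin n → ℝ)) {p : Y →+ Z} (hp : Continuous p) (hpo : IsOpenMap p) {f : V →+ Z}
    (hf : Continuous f) : ∃ g : V →+ Y, Continuous g ∧ ∀ v, p (g v) = f v := by
  let γ : Fin n → ℝ →+ Z := fun j =>
    f.comp (ε.symm.toAddEquiv.toAddMonoidHom.comp (AddMonoidHom.single (fun _ => ℝ) j))
  have hγ : ∀ j, Continuous (γ j) := fun j =>
    hf.comp (ε.symm.continuous.comp (continuous_single (A := fun _ : Fin n => ℝ) j))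
  choose s hs hps using fun j => exists_lift_real hp hpo (hγ j)
  let g : V →+ Y := ∑ j, (s j).comp
    ((Pi.evalAddMonoidHom (fun _ => ℝ) j).comp ε.toAddEquiv.toAddMonoidHom)
  have hg : ∀ v, g v = ∑ j, s j (ε v j) := fun v => by
    rw [AddMonoidHom.finsetSum_apply]
    rfl
  refine ⟨g, ?_, fun v => ?_⟩
  · refine (continuous_finsetSum Finset.univ fun j _ =>
      (hs j).comp ((continuous_apply j).comp ε.continuous)).congr fun v => (hg v).symm
  · rw [hg, map_sum]
    simp_rw [hps]
    change ∑ j, f (ε.symm (Pi.single j (ε v j))) = f v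
    rw [← map_sum, ← map_sum, Finset.univ_sum_single, ε.symm_apply_apply]

end VectorGroups

/-! ### Passage from groups to modules -/

namespace LCAMod

variable {R : Type v} [Ring R]

/-- Division by `N` is continuous in coordinates. It is `R`-linear although `R` need not respect the
coordinates, because it inverts an operation that commutes with every scalar. -/
theorem IsVectorModule.exists_nsmul_inverse {V : LCAMod.{u} R} (hV : V.IsVectorModule) {N : ℕ}
    (hN : N ≠ 0) : ∃ δ : V →L[R] V, (∀ v, N • δ v = v) ∧ ∀ v, δ (N • v) = v := by
  obtain ⟨n, ⟨ε⟩⟩ := hV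
  have hN' : (N : ℝ) ≠ 0 := Nat.cast_ne_zero.2 hN
  let δ : V → V := fun v => ε.symm ((N : ℝ)⁻¹ • ε v)
  have h1 : ∀ v, N • δ v = v := fun v => by
    rw [← map_nsmul ε.symm, ← Nat.cast_smul_eq_nsmul ℝ, smul_smul, mul_inv_cancel₀ hN', one_smul,
      ε.symm_apply_apply]
  have h2 : ∀ v, δ (N • v) = v := fun v => by
    change ε.symm ((N : ℝ)⁻¹ • ε (N • v)) = v
    rw [map_nsmul ε, ← Nat.cast_smul_eq_nsmul ℝ, smul_smul, inv_mul_cancel₀ hN', one_smul,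
      ε.symm_apply_apply]
  refine ⟨⟨⟨⟨δ, fun v w => ?_⟩, fun a v => ?_⟩, ?_⟩, h1, h2⟩
  · simp [δ]
  · calc δ (a • v) = δ (a • N • δ v) := by rw [h1]
      _ = δ (N • a • δ v) := by rw [smul_comm]
      _ = a • δ v := h2 _
  · have h3 : Continuous fun v => (N : ℝ)⁻¹ • ε v :=
      (continuous_const_smul ((N : ℝ)⁻¹)).comp ε.continuous
    exact ε.symm.continuous.comp h3

/-- The averaged group extension restricts to `N • f` on `X`; division by `N` is applied afterwards,
in the target `V`. -/
theorem IsVectorModule.isInjectiveObject (hR : HasAveragingFamily R) {V : LCAMod.{u} R}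
    (hV : V.IsVectorModule) : IsInjectiveObject V := by
  intro X Y i hi f
  obtain ⟨ι, _, e, e', N, hN, hm, hsum⟩ := hR
  obtain ⟨δ, hδ, hδ'⟩ := hV.exists_nsmul_inverse hN
  obtain ⟨n, ⟨ε⟩⟩ := hV
  let i' : X →L[R] Y := i
  let f' : X →L[R] V := f
  obtain ⟨g, hg, hgi⟩ := exists_extension_of_isClosedEmbedding ε
    (i := (i' : X →ₗ[R] Y).toAddMonoidHom) (isClosedEmbedding_of_isAdmissibleMonic i' hi)
    (f := (f' : X →ₗ[R] V).toAddMonoidHom) f'.continuous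
  replace hgi : ∀ x, g (i' x) = f' x := hgi
  let h : Y →L[R] V :=
    { toFun := fun y => ∑ j, e j • g (e' j • y)
      map_add' := fun x y => by simp [smul_add, Finset.sum_add_distrib]
      map_smul' := fun a y => by
        obtain ⟨m, h1, h2⟩ := hm a
        exact (smul_averaged_eq h1 h2 g y).symm
      cont := continuous_finsetSum _ fun j _ => (hg.comp (continuous_const_smul _)).const_smul _ }
  refine ⟨show Y →L[R] V from δ.comp h, ?_⟩
  refine show (δ.comp h).comp i' = f' from ContinuousLinearMap.ext fun x => ?_
  change δ (∑ j, e j • g (e' j • i' x)) = f' x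
  simp_rw [← map_smul i', hgi, map_smul f', smul_smul]
  rw [← Finset.sum_smul, hsum, Nat.cast_smul_eq_nsmul, hδ']

/-- Here division by `N` is applied first, in the source: `Y` need not be divisible. -/
theorem IsVectorModule.isProjectiveObject (hR : HasAveragingFamily R) {V : LCAMod.{u} R}
    (hV : V.IsVectorModule) : IsProjectiveObject V := by
  intro Y Z p hp f
  obtain ⟨ι, _, e, e', N, hN, hm, hsum⟩ := hR
  obtain ⟨δ, hδ, hδ'⟩ := hV.exists_nsmul_inverse hN
  obtain ⟨n, ⟨ε⟩⟩ := hV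
  let p' : Y →L[R] Z := p
  let f' : V →L[R] Z := f
  obtain ⟨g, hg, hpg⟩ := exists_lift_of_isOpenMap ε
    (p := (p' : Y →ₗ[R] Z).toAddMonoidHom) p'.continuous (isOpenMap_of_isAdmissibleEpic p' hp)
    (f := (f' : V →ₗ[R] Z).toAddMonoidHom) f'.continuous
  replace hpg : ∀ v, p' (g v) = f' v := hpg
  let h : V →L[R] Y :=
    { toFun := fun v => ∑ j, e j • g (e' j • v)
      map_add' := fun x y => by simp [smul_add, Finset.sum_add_distrib]
      map_smul' := fun a y => by
        obtain ⟨m, h1, h2⟩ := hm a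
        exact (smul_averaged_eq h1 h2 g y).symm
      cont := continuous_finsetSum _ fun j _ => (hg.comp (continuous_const_smul _)).const_smul _ }
  refine ⟨show V →L[R] Y from h.comp δ, ?_⟩
  refine show p'.comp (h.comp δ) = f' from ContinuousLinearMap.ext fun v => ?_
  change p' (∑ j, e j • g (e' j • δ v)) = f' v
  simp_rw [map_sum, map_smul p', hpg, map_smul f', smul_smul]
  rw [← Finset.sum_smul, hsum, Nat.cast_smul_eq_nsmul, ← map_nsmul, hδ]

end LCAMod

theorem mainTheorem10 {A : Type v} [Ring A] [Algebra ℚ A] [Module.Finite ℚ A]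
    [IsSemisimpleRing A] (𝔄 : Subring A) (h𝔄 : IsOrder 𝔄) :
    (∀ V : RightLCAMod.{u} 𝔄, V.IsVectorModule → IsInjectiveObject V ∧ IsProjectiveObject V) ∧
    (∀ V : LCAMod.{u} 𝔄, V.IsVectorModule → IsInjectiveObject V ∧ IsProjectiveObject V) := by
  have h := h𝔄.hasAveragingFamily
  exact ⟨fun V hV => ⟨hV.isInjectiveObject h.op, hV.isProjectiveObject h.op⟩,
    fun V hV => ⟨hV.isInjectiveObject h, hV.isProjectiveObject h⟩⟩
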